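/- Let $\gamma>1$ and let $k\ge 0$ be an integer. Use coordinates $(t,x)=(x^0,x^1,x^2,x^3)$ on $\mathbb R^{1+3}$, the Minkowski metric $g=\mathrm{diag}(-1,1,1,1)$ to raise and lower indices, and the summation convention. Put $\Gamma(s)=\dfrac{(\gamma-1)^{(\gamma-1)/\gamma}}{\gamma\,e^{\frac{\gamma-1}{\gamma}s}}$, $\;D_t=u^\mu\partial_\mu$, $\;\mathsf\Pi^{\alpha\mu}=g^{\alpha\mu}+u^\alpha u^\mu$. **Background.** Let $T>0$, let $\Omega_t\subset\mathbb R^3$ $(t\in[0,T])$ be such that $\mathscr D=\{(t,x):t\in[0,T],\ x\in\Omega_t\}$ is bounded and relatively open in $[0,T]\times\mathbb R^3$, and let $(s,r,u)\in C^\infty(\overline{\mathscr D})$ (restrictions of smooth functions) satisfy in $\mathscr D$ $$D_ts=0,\qquad D_tr+(\gamma-1)r\,\partial_\mu u^\mu=0,\qquad D_tu^\alpha+\tfrac1{\Gamma+r}\mathsf\Pi^{\alpha\mu}\partial_\mu r=0,\qquad g_{\alpha\beta}u^\alpha u^\beta=-1,\quad u^0>0,$$ where $r>0$ in $\mathscr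 D$, $r=0$ on $\overline{\mathscr D}\setminus\mathscr D$, and, for each $t\in[0,T]$, $r(t,\cdot)$ is comparable on $\Omega_t$ to the distance to $\partial\Omega_t$ (physical vacuum boundary). **Linearized solution.** Let $(\tilde s,\tilde r,\tilde u)\in C^\infty(\overline{\mathscr D})$ satisfy in $\mathscr D$ $$D_t\tilde s=-\tilde u^\mu\partial_\mu s,\qquad D_t\tilde r+\tilde u^\mu\partial_\mu r+(\gamma-1)r\,\partial_\mu\tilde u^\mu=-(\gamma-1)\tilde r\,\partial_\mu u^\mu,\qquad \tilde u_\alpha u^\alpha=0,$$ $$D_t\tilde u^\alpha+\tfrac1{\Gamma+r}\mathsf\Pi^{\alpha\mu}\partial_\mu\tilde r=-\tilde u^\mu\partial_\mu u^\alpha-\tfrac1{\Gamma+r}(\tilde u^\alpha u^\mu+u^\alpha\tilde u^\mu)\partial_\mu r+\tfrac{\Gamma'}{(\Gamma+r)^2}\tilde s\,\mathsf\Pi^{\alpha\mu}\partial_\mu r+\tfrac1{(\Gamma+r)^2}\tilde r\,\mathsf\Pi^{\alpha\mu}\partial_\mu r .$$ **Norms.** With spatial multi-indices $\alpha$ and $L^2=L^2(\Omega_t)$,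 put $\|f\|^2_{H^{j,\sigma}(\Omega_t)}=\sum_{|\alpha|\le j}\|r^\sigma\partial^\alpha f\|^2_{L^2}$ and $$\|(\tilde s,\tilde r,\tilde u)\|^2_{\mathcal H^{2k}(\Omega_t)}=\sum_{|\alpha|\le 2k}\ \sum_{\substack{0\le a\le k\\|\alpha|-a\le k}}\Big(\|r^{\frac{2-\gamma}{2(\gamma-1)}+\frac12+a}\partial^\alpha\tilde s\|^2_{L^2}+\|r^{\frac{2-\gamma}{2(\gamma-1)}+a}\partial^\alpha\tilde r\|^2_{L^2}+\sum_{\mu=0}^{3}\|r^{\frac{2-\gamma}{2(\gamma-1)}+\frac12+a}\partial^\alpha\tilde u^\mu\|^2_{L^2}\Big).$$ Let $N(t)$ be the sum of the $L^\infty(\Omega_t)$ norms of all spacetime derivatives of order $0,\dots,2k+1$ of $s$, $r$ and the components of $u$, and $N_x(t)$ the same sum over purely spatial derivatives only. **Claim.** There are a nondecreasing function $B_2:\mathbb R\to\mathbb R$ and a function $\hat\varepsilon:\mathbb R\to(0,\infty)$, depending only on $\gamma$ and $k$, such that for all $T$, $\Omega_t$, $(s,r,u)$, $(\tilde s,\tilde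 r,\tilde u)$ as above and every $t\in[0,T]$, the function $\tau\mapsto\|\tilde s\|^2_{H^{2k,\,k+\frac1{2(\gamma-1)}}(\Omega_\tau)}$ is differentiable on $[0,T]$ at $t$ (one-sidedly at the end points) and $$\frac{d}{dt}\|\tilde s\|^2_{H^{2k,\,k+\frac1{2(\gamma-1)}}(\Omega_t)}\le B_2\big(N(t)\big)\,\|(\tilde s,\tilde r,\tilde u)\|^2_{\mathcal H^{2k}(\Omega_t)} .$$ Moreover, if $s\le S$ and $r\le\hat\varepsilon(S)$ on $\Omega_t$ for some $S\in\mathbb R$, the same inequality holds with $B_2(N_x(t))$ in place of $B_2(N(t))$. -/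

import Mathlib

open MeasureTheory Set
open scoped ContDiff

noncomputable section

/-- Physical space `ℝ³` with the Euclidean distance and Lebesgue measure. -/
abbrev Space : Type := EuclideanSpace ℝ (Fin 3)

/-- Spacetime `ℝ^{1+3}`: a point is `(t, x)`, with coordinates `x⁰ = t, x¹, x², x³`. -/
abbrev Spacetime : Type := ℝ × Space

/-- The coordinate vectors of spacetime: index `0` is time, indices `1, 2, 3` are space. -/
def coordVec : Fin 4 → Spacetime :=
  Fin.cons ((1 : ℝ), (0 : Space)) fun i => ((0 : ℝ), EuclideanSpace.single i (1 : ℝ))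

/-- The coordinate derivative `∂_μ f`. -/
def pd (μ : Fin 4) (f : Spacetime → ℝ) : Spacetime → ℝ :=
  fun p => fderiv ℝ f p (coordVec μ)

/-- The iterated derivative `∂^α f = ∂₀^{α₀} ∂₁^{α₁} ∂₂^{α₂} ∂₃^{α₃} f`. -/
def pdMulti (α : Fin 4 → ℕ) (f : Spacetime → ℝ) : Spacetime → ℝ :=
  (pd 0)^[α 0] ((pd 1)^[α 1] ((pd 2)^[α 2] ((pd 3)^[α 3] f)))

/-- All spacetime multi-indices of order at most `j`. -/
def spacetimeIdx (j : ℕ) : Finset (Fin 4 → ℕ) :=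
  (Fintype.piFinset fun _ => Finset.range (j + 1)).filter fun α => ∑ μ, α μ ≤ j

/-- The purely spatial multi-indices of order at most `j`. -/
def spatialIdx (j : ℕ) : Finset (Fin 4 → ℕ) :=
  (spacetimeIdx j).filter fun α => α 0 = 0

/-- The fluid variables: entropy `s`, (multiple of the) sound speed squared `r`, and the
contravariant components `u^μ` of the velocity. The same type serves for the linearized
variables. A field on the closed moving domain is represented by an extension to spacetime;
only its values on the closed moving domain matter below. -/
structure FluidFields where
  s : Spacetime → ℝ
  r : Spacetime → ℝ
  u : Fin 4 → Spacetime → ℝ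

/-- All components are (restrictions of) smooth functions. -/
structure FluidFields.Smooth (F : FluidFields) : Prop where
  s : ContDiff ℝ ∞ F.s
  r : ContDiff ℝ ∞ F.r
  u : ∀ μ, ContDiff ℝ ∞ (F.u μ)

/-- The Minkowski metric `g = diag(-1, 1, 1, 1)`; `g_{αβ}` and `g^{αβ}` have the same entries. -/
def mink (α β : Fin 4) : ℝ := if α = β then (if α = 0 then -1 else 1) else 0

/-- `Γ(s) = (γ-1)^{(γ-1)/γ} / (γ e^{(γ-1)s/γ})`. -/
def Gam (γ : ℝ) (s : ℝ) : ℝ :=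
  (γ - 1) ^ ((γ - 1) / γ) / (γ * Real.exp ((γ - 1) / γ * s))

/-- The convective derivative `D_t f = u^μ ∂_μ f`. -/
def Dt (u : Fin 4 → Spacetime → ℝ) (f : Spacetime → ℝ) : Spacetime → ℝ :=
  fun p => ∑ μ, u μ p * pd μ f p

/-- The projection `Π^{αμ} = g^{αμ} + u^α u^μ`. -/
def projU (u : Fin 4 → Spacetime → ℝ) (α μ : Fin 4) (p : Spacetime) : ℝ :=
  mink α μ + u α p * u μ p

/-- The moving domain `{(t, x) : 0 ≤ t ≤ T, x ∈ Ω_t}`. -/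
def movingDomain (T : ℝ) (Ω : ℝ → Set Space) : Set Spacetime :=
  {p | p.1 ∈ Icc 0 T ∧ p.2 ∈ Ω p.1}

/-- A smooth solution `(s, r, u)` on `[0, T]` of the free-boundary relativistic Euler equations of
an ideal gas, in a bounded moving domain, with a physical vacuum boundary. -/
structure IsBackgroundSolution (γ T : ℝ) (Ω : ℝ → Set Space) (F : FluidFields) : Prop where
  smooth : F.Smooth
  /-- The moving domain is relatively open in `[0, T] × ℝ³`. -/
  relOpen : ∃ U : Set Spacetime, IsOpen U ∧
    movingDomain T Ω = U ∩ {p | p.1 ∈ Icc 0 T}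
  bounded : Bornology.IsBounded (movingDomain T Ω)
  r_pos : ∀ p ∈ movingDomain T Ω, 0 < F.r p
  /-- `r` vanishes on the free boundary. -/
  r_boundary : ∀ p ∈ closure (movingDomain T Ω) \ movingDomain T Ω, F.r p = 0
  /-- Physical vacuum: `r` is comparable to the distance to the free boundary. -/
  vacuum : ∀ t ∈ Icc 0 T, ∃ c C : ℝ, 0 < c ∧ ∀ x ∈ Ω t,
    c * Metric.infDist x (frontier (Ω t)) ≤ F.r (t, x) ∧
      F.r (t, x) ≤ C * Metric.infDist x (frontier (Ω t))
  s_eq : ∀ p ∈ movingDomain T Ω, Dt F.u F.s p = 0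
  r_eq : ∀ p ∈ movingDomain T Ω,
    Dt F.u F.r p + (γ - 1) * F.r p * ∑ μ, pd μ (F.u μ) p = 0
  u_eq : ∀ p ∈ movingDomain T Ω, ∀ α,
    Dt F.u (F.u α) p
      + 1 / (Gam γ (F.s p) + F.r p) * ∑ μ, projU F.u α μ p * pd μ F.r p = 0
  u_unit : ∀ p ∈ movingDomain T Ω, ∑ α, ∑ β, mink α β * F.u α p * F.u β p = -1
  /-- The velocity is forward time-like. -/
  u_forward : ∀ p ∈ movingDomain T Ω, 0 < F.u 0 p

/-- A smooth solution `L = (s̃, r̃, ũ)` on `[0, T]` of the equations linearized about the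
background `F = (s, r, u)`. -/
structure IsLinearizedSolution (γ T : ℝ) (Ω : ℝ → Set Space) (F L : FluidFields) : Prop where
  smooth : L.Smooth
  s_eq : ∀ p ∈ movingDomain T Ω, Dt F.u L.s p = -∑ μ, L.u μ p * pd μ F.s p
  r_eq : ∀ p ∈ movingDomain T Ω,
    Dt F.u L.r p + ∑ μ, L.u μ p * pd μ F.r p
        + (γ - 1) * F.r p * ∑ μ, pd μ (L.u μ) p
      = -((γ - 1) * L.r p * ∑ μ, pd μ (F.u μ) p)
  u_eq : ∀ p ∈ movingDomain T Ω, ∀ α,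
    Dt F.u (L.u α) p
        + 1 / (Gam γ (F.s p) + F.r p) * ∑ μ, projU F.u α μ p * pd μ L.r p
      = -(∑ μ, L.u μ p * pd μ (F.u α) p)
        - 1 / (Gam γ (F.s p) + F.r p)
            * ∑ μ, (L.u α p * F.u μ p + F.u α p * L.u μ p) * pd μ F.r p
        + deriv (Gam γ) (F.s p) / (Gam γ (F.s p) + F.r p) ^ 2 * L.s p
            * ∑ μ, projU F.u α μ p * pd μ F.r p
        + 1 / (Gam γ (F.s p) + F.r p) ^ 2 * L.r p
            * ∑ μ, projU F.u α μ p * pd μ F.r p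
  u_orth : ∀ p ∈ movingDomain T Ω, ∑ α, ∑ β, mink α β * L.u α p * F.u β p = 0

/-- `‖r^σ f‖²_{L²(Ω_t)}`. -/
def weightedSq (r : Spacetime → ℝ) (Ω : ℝ → Set Space) (t σ : ℝ) (f : Spacetime → ℝ) : ℝ :=
  ∫ x in Ω t, (r (t, x) ^ σ * f (t, x)) ^ 2

/-- `‖f‖²_{H^{j,σ}(Ω_t)} = ∑_{|α| ≤ j} ‖r^σ ∂^α f‖²_{L²(Ω_t)}`, with spatial derivatives. -/
def sobolevSq (r : Spacetime → ℝ) (Ω : ℝ → Set Space) (t : ℝ) (j : ℕ) (σ : ℝ)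
    (f : Spacetime → ℝ) : ℝ :=
  ∑ α ∈ spatialIdx j, weightedSq r Ω t σ (pdMulti α f)

/-- `‖(s̃, r̃, ũ)‖²_{𝓗^{2k}(Ω_t)}`: the sum over spatial `|α| ≤ 2k` and `0 ≤ a ≤ k` with
`|α| - a ≤ k`. -/
def energySq (γ : ℝ) (k : ℕ) (r : Spacetime → ℝ) (Ω : ℝ → Set Space) (t : ℝ)
    (L : FluidFields) : ℝ :=
  ∑ α ∈ spatialIdx (2 * k),
    ∑ a ∈ (Finset.range (k + 1)).filter (fun a => ∑ μ, α μ ≤ k + a),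
      (weightedSq r Ω t ((2 - γ) / (2 * (γ - 1)) + 1 / 2 + a) (pdMulti α L.s)
        + weightedSq r Ω t ((2 - γ) / (2 * (γ - 1)) + a) (pdMulti α L.r)
        + ∑ μ, weightedSq r Ω t ((2 - γ) / (2 * (γ - 1)) + 1 / 2 + a) (pdMulti α (L.u μ)))

/-- `‖f(t, ·)‖_{L^∞(Ω_t)}`. -/
def supNorm (Ω : ℝ → Set Space) (t : ℝ) (f : Spacetime → ℝ) : ℝ :=
  (eLpNorm (fun x => f (t, x)) ⊤ (volume.restrict (Ω t))).toReal

/-- The sum of the `L^∞(Ω_t)` norms of the derivatives `∂^α (s, r, u)`, `α ∈ J`. -/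
def derivSup (J : Finset (Fin 4 → ℕ)) (Ω : ℝ → Set Space) (t : ℝ) (F : FluidFields) : ℝ :=
  ∑ α ∈ J, (supNorm Ω t (pdMulti α F.s) + supNorm Ω t (pdMulti α F.r)
    + ∑ μ, supNorm Ω t (pdMulti α (F.u μ)))

end

/-!
The entropy norm is a sum of integrals `∫_{Ω_t} r^q φ` with `φ = (∂^α s̃)²` and
`q = 2k + 1/(γ-1) > 0`. Two things have to be shown: that such an integral is differentiable in
time although `Ω_t` moves and `r^q` need not be differentiable at the free boundary, and that the
derivative is bounded by the energy.

*Differentiability.* The weight is itself transported: `D_t r = -(γ-1) r ∂_μ u^μ` gives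
`D_t (r^q) = -q (γ-1) (∂_μ u^μ) r^q` with no loss in the power of `r`. Instead of following the
flow, `r^q` is replaced by the `C¹` cut-off `cutPow q ε r`, which vanishes for `r ≤ ε`. Since `r = 0`
on the free boundary, the product of the cut-off with a smooth function extends by zero to a `C¹`
function on `[0, T] × ℝ³` with bounded support; for it the integral may be differentiated, and
spatial divergences integrate to zero. The Euler derivative `r d/dr` of the cut-off is bounded by a
multiple of `r^q` uniformly in `ε`, so the integrated identity passes to the limit `ε → 0`. The
limiting density `r^q ψ` is continuous up to zero extension, and the fundamental theorem of calculus
gives `IsBackgroundSolution.hasDerivWithinAt_integral_rpow`.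

*The bound.* The density contains `∂^α s̃ D_t ∂^α s̃`. Applying `∂^α` to
`D_t s̃ = -ũ^μ ∂_μ s` leaves a commutator that contains only `∂_μ ∂^β s̃` with `|β| < |α|`. For
`μ = 0` these are controlled by induction from the same equation, because `u⁰ ≥ 1`; the time
derivatives of `s` are treated alike. This is `exists_abs_Dt_pdMulti_linearized_le`: the derivatives of `s̃` and
`ũ` of order at most `2k` suffice, and they occur in the energy with exactly the weight `r^{q/2}`
(the terms `a = k`), so no Hardy inequality is needed.

All constants so far depend on spatial derivatives of the background only, except for the term
`∂_t u⁰` in `∂_μ u^μ`. It is part of `N(t)`. If `r ≤ Γ(S)/(2(γ-1))` and `s ≤ S`, then eliminating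
`∂_t r` from the equations for `r` and `u⁰` expresses it through spatial derivatives
(`IsBackgroundSolution.exists_abs_pd_zero_u_zero_le`).
-/

noncomputable section

/-! ### Calculus of coordinate derivatives -/

section PartialDerivatives

variable {f g : Spacetime → ℝ}

lemma ContDiff.pd (hf : ContDiff ℝ ∞ f) (μ : Fin 4) : ContDiff ℝ ∞ (pd μ f) :=
  (hf.fderiv_right (m := ∞) (by simp)).clm_apply contDiff_const

lemma ContDiff.differentiableAt_of_smooth (hf : ContDiff ℝ ∞ f) (p : Spacetime) :
    DifferentiableAt ℝ f p :=
  hf.differentiable (by simp) p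

lemma ContDiff.pd_iterate (hf : ContDiff ℝ ∞ f) (μ : Fin 4) (n : ℕ) :
    ContDiff ℝ ∞ ((_root_.pd μ)^[n] f) := by
  induction n with
  | zero => exact hf
  | succ n ih => rw [Function.iterate_succ_apply']; exact ih.pd μ

lemma ContDiff.pdMulti (hf : ContDiff ℝ ∞ f) (α : Fin 4 → ℕ) :
    ContDiff ℝ ∞ (pdMulti α f) :=
  (((hf.pd_iterate 3 _).pd_iterate 2 _).pd_iterate 1 _).pd_iterate 0 _

lemma pd_add (hf : ContDiff ℝ ∞ f) (hg : ContDiff ℝ ∞ g) (μ : Fin 4) :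
    pd μ (fun p => f p + g p) = fun p => pd μ f p + pd μ g p := by
  ext p
  simp only [pd]
  rw [fderiv_fun_add (hf.differentiableAt_of_smooth p) (hg.differentiableAt_of_smooth p)]
  rfl

lemma pd_mul (hf : ContDiff ℝ ∞ f) (hg : ContDiff ℝ ∞ g) (μ : Fin 4) :
    pd μ (fun p => f p * g p) = fun p => pd μ f p * g p + f p * pd μ g p := by
  ext p
  simp only [pd]
  rw [fderiv_fun_mul (hf.differentiableAt_of_smooth p) (hg.differentiableAt_of_smooth p)]
  simp only [_root_.add_apply, _root_.smul_apply, smul_eq_mul]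
  ring

lemma pd_zero (μ : Fin 4) : pd μ (fun _ => 0) = fun _ => 0 := by
  ext p; simp [pd]

lemma pd_comm (hf : ContDiff ℝ ∞ f) (μ ν : Fin 4) : pd μ (pd ν f) = pd ν (pd μ f) := by
  have hd : Differentiable ℝ (fderiv ℝ f) :=
    (hf.fderiv_right (m := ∞) (by simp)).differentiable (by simp)
  have key : ∀ (μ ν : Fin 4) (p : Spacetime),
      pd μ (pd ν f) p = fderiv ℝ (fderiv ℝ f) p (coordVec μ) (coordVec ν) := by
    intro μ ν p
    have h : pd μ (pd ν f) p
        = fderiv ℝ (fun y => fderiv ℝ f y (coordVec ν)) p (coordVec μ) := rfl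
    rw [h, fderiv_clm_apply (hd p) (differentiableAt_const _)]
    simp
  ext p
  rw [key, key]
  exact (hf.contDiffAt.isSymmSndFDerivAt (by
    rw [minSmoothness_of_isRCLikeNormedField]; exact WithTop.coe_le_coe.2 le_top)) _ _

lemma pd_iterate_comm (hf : ContDiff ℝ ∞ f) (μ ν : Fin 4) (n : ℕ) :
    pd μ ((pd ν)^[n] f) = (pd ν)^[n] (pd μ f) := by
  induction n generalizing f with
  | zero => rfl
  | succ n ih =>
    rw [Function.iterate_succ_apply, Function.iterate_succ_apply, ih (hf.pd ν), pd_comm hf]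

lemma pdMulti_add_single (hf : ContDiff ℝ ∞ f) (α : Fin 4 → ℕ) (μ : Fin 4) :
    pdMulti (α + Pi.single μ 1) f = pdMulti α (pd μ f) := by
  have h3 := hf.pd_iterate 3 (α 3)
  have h2 := h3.pd_iterate 2 (α 2)
  fin_cases μ
  · simp [pdMulti, Function.iterate_succ_apply, pd_iterate_comm h2, pd_iterate_comm h3,
      pd_iterate_comm hf]
  · simp [pdMulti, Function.iterate_succ_apply, pd_iterate_comm h3, pd_iterate_comm hf]
  · simp [pdMulti, Function.iterate_succ_apply, pd_iterate_comm hf]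
  · simp [pdMulti, Function.iterate_succ_apply]

lemma pdMulti_zero : pdMulti 0 f = f := rfl

lemma pdMulti_pd (hf : ContDiff ℝ ∞ f) (α : Fin 4 → ℕ) (μ : Fin 4) :
    pdMulti α (pd μ f) = pd μ (pdMulti α f) := by
  have h3 := hf.pd_iterate 3 (α 3)
  have h2 := h3.pd_iterate 2 (α 2)
  have h1 := h2.pd_iterate 1 (α 1)
  simp only [pdMulti]
  rw [pd_iterate_comm h1, pd_iterate_comm h2, pd_iterate_comm h3, pd_iterate_comm hf]

end PartialDerivatives

/-! ### Spatial multi-indices -/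

lemma mem_spacetimeIdx {n : ℕ} {α : Fin 4 → ℕ} : α ∈ spacetimeIdx n ↔ ∑ μ, α μ ≤ n := by
  simp only [spacetimeIdx, Finset.mem_filter, Fintype.mem_piFinset, Finset.mem_range,
    and_iff_right_iff_imp]
  intro h μ
  exact Nat.lt_succ_of_le ((Finset.single_le_sum (fun _ _ => Nat.zero_le _)
    (Finset.mem_univ μ)).trans h)

lemma mem_spatialIdx {n : ℕ} {α : Fin 4 → ℕ} :
    α ∈ spatialIdx n ↔ ∑ μ, α μ ≤ n ∧ α 0 = 0 := by
  simp only [spatialIdx, Finset.mem_filter, mem_spacetimeIdx]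

lemma spatialIdx_subset_spacetimeIdx (n : ℕ) : spatialIdx n ⊆ spacetimeIdx n :=
  Finset.filter_subset _ _

lemma spatialIdx_mono {m n : ℕ} (h : m ≤ n) : spatialIdx m ⊆ spatialIdx n := by
  intro α hα
  rw [mem_spatialIdx] at hα ⊢
  exact ⟨hα.1.trans h, hα.2⟩

lemma zero_mem_spatialIdx (n : ℕ) : (0 : Fin 4 → ℕ) ∈ spatialIdx n := by
  simp [mem_spatialIdx]

lemma sum_add_single (α : Fin 4 → ℕ) (μ : Fin 4) :
    ∑ ν, (α + Pi.single μ 1 : Fin 4 → ℕ) ν = ∑ ν, α ν + 1 := by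
  simp [Finset.sum_add_distrib]

lemma add_single_mem_spatialIdx {n : ℕ} {α : Fin 4 → ℕ} (hα : α ∈ spatialIdx n) {i : Fin 4}
    (hi : i ≠ 0) : α + Pi.single i 1 ∈ spatialIdx (n + 1) := by
  rw [mem_spatialIdx] at hα ⊢
  rw [sum_add_single]
  exact ⟨by omega, by simp [hα.2, hi.symm]⟩

/-- Every spatial multi-index is `0` or arises from a shorter one by one more spatial
derivative. -/
lemma eq_zero_or_add_single {n : ℕ} {α : Fin 4 → ℕ} (hα : α ∈ spatialIdx (n + 1)) :
    α = 0 ∨ ∃ β ∈ spatialIdx n, ∃ i : Fin 4, i ≠ 0 ∧ α = β + Pi.single i 1 := by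
  rw [mem_spatialIdx] at hα
  by_cases h : α = 0
  · exact Or.inl h
  obtain ⟨i, hi⟩ : ∃ i, α i ≠ 0 := by
    by_contra! hc
    exact h (funext hc)
  have hle : Pi.single i 1 ≤ α := by
    intro j
    by_cases hj : j = i
    · subst hj; simp; omega
    · simp [hj]
  have hi0 : i ≠ 0 := by rintro rfl; exact hi hα.2
  have heq : α = (α - Pi.single i 1) + Pi.single i 1 := (tsub_add_cancel_of_le hle).symm
  refine Or.inr ⟨α - Pi.single i 1, ?_, i, hi0, heq⟩
  rw [mem_spatialIdx]
  have h1 := sum_add_single (α - Pi.single i 1) i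
  rw [← heq] at h1
  exact ⟨by omega, by simp [hα.2]⟩

lemma eq_zero_of_mem_spatialIdx_zero {α : Fin 4 → ℕ} (hα : α ∈ spatialIdx 0) : α = 0 := by
  rw [mem_spatialIdx] at hα
  ext μ
  simpa using (Finset.sum_eq_zero_iff.1 (Nat.le_zero.1 hα.1)) μ (Finset.mem_univ μ)

/-- `∑_{|α| ≤ n} |∂^α f(p)|`, the sum being over spatial multi-indices. -/
def jetSum (n : ℕ) (f : Spacetime → ℝ) (p : Spacetime) : ℝ :=
  ∑ α ∈ spatialIdx n, |pdMulti α f p|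

section JetSum

variable {f g : Spacetime → ℝ}

lemma jetSum_nonneg (n : ℕ) (f : Spacetime → ℝ) (p : Spacetime) : 0 ≤ jetSum n f p :=
  Finset.sum_nonneg fun _ _ => abs_nonneg _

lemma abs_pdMulti_le_jetSum {n : ℕ} {α : Fin 4 → ℕ} (hα : α ∈ spatialIdx n)
    (f : Spacetime → ℝ) (p : Spacetime) : |pdMulti α f p| ≤ jetSum n f p :=
  Finset.single_le_sum (f := fun α => |pdMulti α f p|) (fun _ _ => abs_nonneg _) hα

lemma abs_le_jetSum (n : ℕ) (f : Spacetime → ℝ) (p : Spacetime) : |f p| ≤ jetSum n f p :=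
  abs_pdMulti_le_jetSum (zero_mem_spatialIdx n) f p

lemma jetSum_mono {m n : ℕ} (h : m ≤ n) (f : Spacetime → ℝ) (p : Spacetime) :
    jetSum m f p ≤ jetSum n f p :=
  Finset.sum_le_sum_of_subset_of_nonneg (spatialIdx_mono h) fun _ _ _ => abs_nonneg _

lemma jetSum_pd_le (hf : ContDiff ℝ ∞ f) (n : ℕ) {i : Fin 4} (hi : i ≠ 0) (p : Spacetime) :
    jetSum n (pd i f) p ≤ jetSum (n + 1) f p := by
  have hinj : Set.InjOn (fun α : Fin 4 → ℕ => α + Pi.single i 1) (spatialIdx n) :=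
    fun α _ β _ h => add_right_cancel h
  calc jetSum n (pd i f) p = ∑ α ∈ spatialIdx n, |pdMulti (α + Pi.single i 1) f p| := by
        simp only [jetSum, pdMulti_add_single hf]
    _ = ∑ α ∈ (spatialIdx n).image (fun α => α + Pi.single i 1), |pdMulti α f p| :=
        (Finset.sum_image (f := fun α => |pdMulti α f p|) hinj).symm
    _ ≤ jetSum (n + 1) f p := by
        refine Finset.sum_le_sum_of_subset_of_nonneg ?_ fun _ _ _ => abs_nonneg _
        intro α hα
        obtain ⟨β, hβ, rfl⟩ := Finset.mem_image.1 hα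
        exact add_single_mem_spatialIdx hβ hi

/-- Induction on spatial multi-indices, adding one spatial derivative at a time. -/
lemma spatial_induction {α : Fin 4 → ℕ} (hα : α 0 = 0)
    {P : (Fin 4 → ℕ) → Prop} (h0 : P 0)
    (hs : ∀ β : Fin 4 → ℕ, β 0 = 0 → ∀ i : Fin 4, i ≠ 0 → P β → P (β + Pi.single i 1)) :
    P α := by
  have : ∀ n, ∀ α ∈ spatialIdx n, P α := by
    intro n
    induction n with
    | zero => intro α hα; rw [eq_zero_of_mem_spatialIdx_zero hα]; exact h0
    | succ n ih =>
      intro α hα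
      rcases eq_zero_or_add_single hα with rfl | ⟨β, hβ, i, hi, rfl⟩
      · exact h0
      · exact hs β (mem_spatialIdx.1 hβ).2 i hi (ih β hβ)
  exact this (∑ μ, α μ) α (mem_spatialIdx.2 ⟨le_rfl, hα⟩)

lemma pdMulti_add (hf : ContDiff ℝ ∞ f) (hg : ContDiff ℝ ∞ g) {α : Fin 4 → ℕ} (hα : α 0 = 0) :
    pdMulti α (fun p => f p + g p) = fun p => pdMulti α f p + pdMulti α g p := by
  have : ∀ f g : Spacetime → ℝ, ContDiff ℝ ∞ f → ContDiff ℝ ∞ g →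
      pdMulti α (fun p => f p + g p) = fun p => pdMulti α f p + pdMulti α g p := by
    refine spatial_induction (P := fun α => ∀ f g : Spacetime → ℝ, ContDiff ℝ ∞ f →
      ContDiff ℝ ∞ g → pdMulti α (fun p => f p + g p) = fun p => pdMulti α f p + pdMulti α g p)
      hα (fun _ _ _ _ => rfl) ?_
    intro β _ i _ ih f g hf hg
    rw [pdMulti_add_single (hf.add hg), pd_add hf hg, ih _ _ (hf.pd i) (hg.pd i),
      pdMulti_add_single hf, pdMulti_add_single hg]
  exact this f g hf hg

lemma pdMulti_const_zero {α : Fin 4 → ℕ} (hα : α 0 = 0) :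
    pdMulti α (fun _ => 0) = fun _ => 0 := by
  refine spatial_induction (P := fun α => pdMulti α (fun _ => 0) = fun _ => 0) hα rfl ?_
  intro β _ i _ ih
  rw [pdMulti_add_single contDiff_const, pd_zero, ih]

lemma pdMulti_sum {ι : Type*} (S : Finset ι) {F : ι → Spacetime → ℝ}
    (hF : ∀ i, ContDiff ℝ ∞ (F i)) {α : Fin 4 → ℕ} (hα : α 0 = 0) :
    pdMulti α (fun p => ∑ i ∈ S, F i p) = fun p => ∑ i ∈ S, pdMulti α (F i) p := by
  classical
  induction S using Finset.induction_on with
  | empty => simpa using pdMulti_const_zero hα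
  | insert i S hi ih =>
    simp only [Finset.sum_insert hi]
    rw [pdMulti_add (hF i) (ContDiff.sum fun j _ => hF j) hα, ih]

/-- Leibniz rule, as an inequality. -/
lemma abs_pdMulti_mul_le (n : ℕ) : ∀ {f g : Spacetime → ℝ}, ContDiff ℝ ∞ f → ContDiff ℝ ∞ g →
    ∀ {α : Fin 4 → ℕ}, α ∈ spatialIdx n → ∀ p,
      |pdMulti α (fun p => f p * g p) p| ≤ 2 ^ n * (jetSum n f p * jetSum n g p) := by
  induction n with
  | zero =>
    intro f g hf hg α hα p
    rw [eq_zero_of_mem_spatialIdx_zero hα, pdMulti_zero, abs_mul, pow_zero, one_mul]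
    exact mul_le_mul (abs_le_jetSum 0 f p) (abs_le_jetSum 0 g p) (abs_nonneg _)
      (jetSum_nonneg _ _ _)
  | succ n ih =>
    intro f g hf hg α hα p
    have hnf := jetSum_nonneg (n + 1) f p
    have hng := jetSum_nonneg (n + 1) g p
    rcases eq_zero_or_add_single hα with rfl | ⟨β, hβ, i, hi, rfl⟩
    · rw [pdMulti_zero, abs_mul]
      have h1 : |f p| * |g p| ≤ jetSum (n + 1) f p * jetSum (n + 1) g p :=
        mul_le_mul (abs_le_jetSum _ f p) (abs_le_jetSum _ g p) (abs_nonneg _) hnf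
      exact h1.trans (le_mul_of_one_le_left (mul_nonneg hnf hng) (one_le_pow₀ (by norm_num)))
    · rw [pdMulti_add_single (hf.mul hg), pd_mul hf hg,
        pdMulti_add ((hf.pd i).mul hg) (hf.mul (hg.pd i)) (mem_spatialIdx.1 hβ).2]
      have h1 := ih (hf.pd i) hg hβ p
      have h2 := ih hf (hg.pd i) hβ p
      have h3 : jetSum n (pd i f) p * jetSum n g p ≤ jetSum (n + 1) f p * jetSum (n + 1) g p :=
        mul_le_mul (jetSum_pd_le hf n hi p) (jetSum_mono n.le_succ g p)
          (jetSum_nonneg _ _ _) hnf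
      have h4 : jetSum n f p * jetSum n (pd i g) p ≤ jetSum (n + 1) f p * jetSum (n + 1) g p :=
        mul_le_mul (jetSum_mono n.le_succ f p) (jetSum_pd_le hg n hi p)
          (jetSum_nonneg _ _ _) hnf
      have h5 : (0 : ℝ) < 2 ^ n := by positivity
      refine (abs_add_le _ _).trans ?_
      rw [pow_succ]
      nlinarith [mul_le_mul_of_nonneg_left h3 h5.le, mul_le_mul_of_nonneg_left h4 h5.le]

lemma jetSum_mul_le (n : ℕ) (hf : ContDiff ℝ ∞ f) (hg : ContDiff ℝ ∞ g) (p : Spacetime) :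
    jetSum n (fun p => f p * g p) p
      ≤ (spatialIdx n).card * 2 ^ n * (jetSum n f p * jetSum n g p) := by
  refine (Finset.sum_le_card_nsmul _ _ _ fun α hα => abs_pdMulti_mul_le n hf hg hα p).trans ?_
  rw [nsmul_eq_mul, mul_assoc]

/-- The commutator of `∂^α` with multiplication by `f` loses one derivative of the other
factor. -/
lemma abs_commutator_le (n : ℕ) : ∀ {f g : Spacetime → ℝ}, ContDiff ℝ ∞ f → ContDiff ℝ ∞ g →
    ∀ {α : Fin 4 → ℕ}, α ∈ spatialIdx (n + 1) → ∀ p,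
      |pdMulti α (fun p => f p * g p) p - f p * pdMulti α g p|
        ≤ 2 ^ (n + 1) * (jetSum (n + 1) f p * jetSum n g p) := by
  have step : ∀ (n : ℕ) {f g : Spacetime → ℝ}, ContDiff ℝ ∞ f → ContDiff ℝ ∞ g →
      ∀ {β : Fin 4 → ℕ}, β ∈ spatialIdx n → ∀ {i : Fin 4}, i ≠ 0 → ∀ p,
      |pdMulti β (fun p => f p * pd i g p) p - f p * pdMulti β (pd i g) p|
        ≤ 2 ^ n * (jetSum (n + 1) f p * jetSum n g p) →
      |pdMulti (β + Pi.single i 1) (fun p => f p * g p) p - f p * pdMulti (β + Pi.single i 1) g p|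
        ≤ 2 ^ (n + 1) * (jetSum (n + 1) f p * jetSum n g p) := by
    intro n f g hf hg β hβ i hi p h
    rw [pdMulti_add_single (hf.mul hg), pd_mul hf hg,
      pdMulti_add ((hf.pd i).mul hg) (hf.mul (hg.pd i)) (mem_spatialIdx.1 hβ).2,
      pdMulti_add_single hg]
    have h1 := abs_pdMulti_mul_le n (hf.pd i) hg hβ p
    have h3 : jetSum n (pd i f) p * jetSum n g p ≤ jetSum (n + 1) f p * jetSum n g p :=
      mul_le_mul_of_nonneg_right (jetSum_pd_le hf n hi p) (jetSum_nonneg _ _ _)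
    have h5 : (0 : ℝ) < 2 ^ n := by positivity
    simp only [add_sub_assoc]
    refine (abs_add_le _ _).trans ?_
    rw [pow_succ]
    linarith [mul_le_mul_of_nonneg_left h3 h5.le]
  induction n with
  | zero =>
    intro f g hf hg α hα p
    rcases eq_zero_or_add_single hα with rfl | ⟨β, hβ, i, hi, rfl⟩
    · have := jetSum_nonneg 1 f p
      have := jetSum_nonneg 0 g p
      rw [pdMulti_zero, pdMulti_zero, sub_self, abs_zero]
      positivity
    · refine step 0 hf hg hβ hi p ?_
      rw [eq_zero_of_mem_spatialIdx_zero hβ, pdMulti_zero, pdMulti_zero, sub_self, abs_zero]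
      have := jetSum_nonneg 1 f p
      have := jetSum_nonneg 0 g p
      positivity
  | succ n ih =>
    intro f g hf hg α hα p
    have hF := jetSum_nonneg (n + 1 + 1) f p
    have hG := jetSum_nonneg (n + 1) g p
    rcases eq_zero_or_add_single hα with rfl | ⟨β, hβ, i, hi, rfl⟩
    · rw [pdMulti_zero, pdMulti_zero, sub_self, abs_zero]
      positivity
    · refine step (n + 1) hf hg hβ hi p ((ih hf (hg.pd i) hβ p).trans ?_)
      exact mul_le_mul_of_nonneg_left (mul_le_mul (jetSum_mono (n + 1).le_succ f p)
        (jetSum_pd_le hg n hi p) (jetSum_nonneg _ _ _) hF) (by positivity)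

end JetSum

/-! ### Spatial derivatives of identities on a time slice -/

lemma coordVec_fst {i : Fin 4} (hi : i ≠ 0) : (coordVec i).1 = 0 := by
  obtain ⟨j, rfl⟩ := Fin.exists_succ_eq.2 hi
  simp [coordVec]

lemma pd_eq_of_eqOn_slice {f g : Spacetime → ℝ} (hf : ContDiff ℝ ∞ f) (hg : ContDiff ℝ ∞ g)
    {t : ℝ} {O : Set Space} (hO : IsOpen O) (h : ∀ x ∈ O, f (t, x) = g (t, x)) {i : Fin 4}
    (hi : i ≠ 0) : ∀ x ∈ O, pd i f (t, x) = pd i g (t, x) := by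
  intro x hx
  have hv : coordVec i = (0, (coordVec i).2) := Prod.ext (coordVec_fst hi) rfl
  simp only [pd]
  rw [← (hf.differentiableAt_of_smooth _).lineDeriv_eq_fderiv,
    ← (hg.differentiableAt_of_smooth _).lineDeriv_eq_fderiv]
  simp only [lineDeriv]
  refine Filter.EventuallyEq.deriv_eq ?_
  have hc : Continuous fun s : ℝ => x + s • (coordVec i).2 := by fun_prop
  have : ∀ᶠ s in nhds (0 : ℝ), x + s • (coordVec i).2 ∈ O :=
    hc.continuousAt.eventually_mem (by simpa using hO.mem_nhds hx)
  filter_upwards [this] with s hs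
  rw [hv]
  simpa using h _ hs

lemma pdMulti_eq_of_eqOn_slice {f g : Spacetime → ℝ} (hf : ContDiff ℝ ∞ f)
    (hg : ContDiff ℝ ∞ g) {t : ℝ} {O : Set Space} (hO : IsOpen O)
    (h : ∀ x ∈ O, f (t, x) = g (t, x)) {α : Fin 4 → ℕ} (hα : α 0 = 0) :
    ∀ x ∈ O, pdMulti α f (t, x) = pdMulti α g (t, x) := by
  have : ∀ f g : Spacetime → ℝ, ContDiff ℝ ∞ f → ContDiff ℝ ∞ g →
      (∀ x ∈ O, f (t, x) = g (t, x)) → ∀ x ∈ O, pdMulti α f (t, x) = pdMulti α g (t, x) := by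
    refine spatial_induction (P := fun α => ∀ f g : Spacetime → ℝ, ContDiff ℝ ∞ f →
      ContDiff ℝ ∞ g → (∀ x ∈ O, f (t, x) = g (t, x)) →
        ∀ x ∈ O, pdMulti α f (t, x) = pdMulti α g (t, x)) hα (fun _ _ _ _ h => h) ?_
    intro β _ i hi ih f g hf hg h
    rw [pdMulti_add_single hf, pdMulti_add_single hg]
    exact ih _ _ (hf.pd i) (hg.pd i) (pd_eq_of_eqOn_slice hf hg hO h hi)
  exact this f g hf hg h

/-! ### Transport equations differentiated in space -/

lemma jetSum_sum_le {ι : Type*} (S : Finset ι) {F : ι → Spacetime → ℝ}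
    (hF : ∀ i, ContDiff ℝ ∞ (F i)) (n : ℕ) (p : Spacetime) :
    jetSum n (fun p => ∑ i ∈ S, F i p) p ≤ ∑ i ∈ S, jetSum n (F i) p := by
  simp only [jetSum]
  rw [Finset.sum_comm]
  refine Finset.sum_le_sum fun α hα => ?_
  rw [pdMulti_sum S hF (mem_spatialIdx.1 hα).2]
  exact Finset.abs_sum_le_sum_abs _ _

lemma sum_pdMulti_add_eq_zero {u : Fin 4 → Spacetime → ℝ} {f h : Spacetime → ℝ}
    (hu : ∀ μ, ContDiff ℝ ∞ (u μ)) (hf : ContDiff ℝ ∞ f) (hh : ContDiff ℝ ∞ h) {t : ℝ}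
    {O : Set Space} (hO : IsOpen O) (heq : ∀ x ∈ O, Dt u f (t, x) + h (t, x) = 0)
    {α : Fin 4 → ℕ} (hα : α 0 = 0) {x : Space} (hx : x ∈ O) :
    ∑ μ, pdMulti α (fun p => u μ p * pd μ f p) (t, x) + pdMulti α h (t, x) = 0 := by
  have hsm : ∀ μ, ContDiff ℝ ∞ (fun p => u μ p * pd μ f p) := fun μ => (hu μ).mul (hf.pd μ)
  have hDt : ContDiff ℝ ∞ (Dt u f) := ContDiff.sum fun μ _ => hsm μ
  have h0 := pdMulti_eq_of_eqOn_slice (hDt.add hh) contDiff_const hO heq hα x hx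
  rw [pdMulti_const_zero hα, pdMulti_add hDt hh hα] at h0
  have h1 : pdMulti α (Dt u f) (t, x) = ∑ μ, pdMulti α (fun p => u μ p * pd μ f p) (t, x) :=
    congrFun (pdMulti_sum Finset.univ hsm hα) (t, x)
  rw [← h1]
  exact h0

/-- If `u^μ ∂_μ f + h = 0` on an open set in a time slice, where `u⁰ ≥ 1`, then the spatial
derivatives of `∂_t f` are controlled by those of `f` and `h`. -/
lemma exists_jetSum_pd_zero_le (n : ℕ) (A : ℝ) : ∃ C, 0 ≤ C ∧
    ∀ (u : Fin 4 → Spacetime → ℝ) (f h : Spacetime → ℝ), (∀ μ, ContDiff ℝ ∞ (u μ)) →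
      ContDiff ℝ ∞ f → ContDiff ℝ ∞ h → ∀ (t : ℝ) (O : Set Space), IsOpen O →
      (∀ x ∈ O, Dt u f (t, x) + h (t, x) = 0) → ∀ x ∈ O, 1 ≤ u 0 (t, x) →
      (∀ μ, jetSum n (u μ) (t, x) ≤ A) →
      jetSum n (pd 0 f) (t, x) ≤ C * (jetSum (n + 1) f (t, x) + jetSum n h (t, x)) := by
  -- The estimate of `∂^α ∂_t f` for given bounds on the commutator `[∂^α, u⁰] ∂_t f`.
  have main : ∀ (n : ℕ) (D : ℝ), 0 ≤ D → ∃ C, 0 ≤ C ∧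
      ∀ (u : Fin 4 → Spacetime → ℝ) (f h : Spacetime → ℝ), (∀ μ, ContDiff ℝ ∞ (u μ)) →
      ContDiff ℝ ∞ f → ContDiff ℝ ∞ h → ∀ (t : ℝ) (O : Set Space), IsOpen O →
      (∀ x ∈ O, Dt u f (t, x) + h (t, x) = 0) → ∀ x ∈ O, 1 ≤ u 0 (t, x) →
      (∀ μ, jetSum n (u μ) (t, x) ≤ A) →
      (∀ α ∈ spatialIdx n, |pdMulti α (fun p => u 0 p * pd 0 f p) (t, x)
          - u 0 (t, x) * pdMulti α (pd 0 f) (t, x)|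
        ≤ D * (jetSum (n + 1) f (t, x) + jetSum n h (t, x))) →
      jetSum n (pd 0 f) (t, x) ≤ C * (jetSum (n + 1) f (t, x) + jetSum n h (t, x)) := by
    intro n D hD
    refine ⟨(spatialIdx n).card * (3 * (2 ^ n * |A|) + 1 + D), by positivity, ?_⟩
    intro u f h hu hf hh t O hO heq x hx hu0 hA hcomm
    set p : Spacetime := (t, x)
    have hFn := jetSum_nonneg (n + 1) f p
    have hHn := jetSum_nonneg n h p
    set X := jetSum (n + 1) f p + jetSum n h p with hX
    have hX0 : 0 ≤ X := by positivity
    have hterm : ∀ α ∈ spatialIdx n,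
        |pdMulti α (pd 0 f) p| ≤ (3 * (2 ^ n * |A|) + 1 + D) * X := by
      intro α hα
      have hα0 := (mem_spatialIdx.1 hα).2
      have h0 := sum_pdMulti_add_eq_zero hu hf hh hO heq hα0 hx
      rw [show ((t, x) : Spacetime) = p from rfl, Fin.sum_univ_succ] at h0
      have h2 : |∑ i : Fin 3, pdMulti α (fun p => u i.succ p * pd i.succ f p) p|
          ≤ 3 * (2 ^ n * |A|) * X := by
        refine (Finset.abs_sum_le_sum_abs _ _).trans ?_
        have : ∀ i ∈ (Finset.univ : Finset (Fin 3)),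
            |pdMulti α (fun p => u i.succ p * pd i.succ f p) p| ≤ 2 ^ n * |A| * X := by
          intro i _
          refine (abs_pdMulti_mul_le n (hu _) (hf.pd _) hα p).trans ?_
          rw [mul_assoc]
          refine mul_le_mul_of_nonneg_left ?_ (by positivity)
          refine mul_le_mul ((hA _).trans (le_abs_self A)) ?_ (jetSum_nonneg _ _ _) (abs_nonneg A)
          exact (jetSum_pd_le hf n (Fin.succ_ne_zero i) p).trans (by rw [hX]; linarith)
        refine (Finset.sum_le_card_nsmul _ _ _ this).trans_eq ?_
        simp; ring
      have h3 : |pdMulti α h p| ≤ X := (abs_pdMulti_le_jetSum hα h p).trans (by rw [hX]; linarith)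
      have h4 := hcomm α hα
      have h5 : |pdMulti α (pd 0 f) p| ≤ |u 0 p * pdMulti α (pd 0 f) p| := by
        rw [abs_mul]
        exact le_mul_of_one_le_left (abs_nonneg _) (hu0.trans (le_abs_self _))
      have h6 : u 0 p * pdMulti α (pd 0 f) p
          = -(∑ i : Fin 3, pdMulti α (fun p => u i.succ p * pd i.succ f p) p)
            - pdMulti α h p - (pdMulti α (fun p => u 0 p * pd 0 f p) p
              - u 0 p * pdMulti α (pd 0 f) p) := by linarith
      refine h5.trans ?_
      rw [h6]
      refine (abs_sub _ _).trans ((add_le_add_left (abs_sub _ _) _).trans ?_)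
      rw [abs_neg]
      linarith
    refine (Finset.sum_le_card_nsmul _ _ _ hterm).trans_eq ?_
    rw [nsmul_eq_mul, mul_assoc]
  induction n with
  | zero =>
    obtain ⟨C, hC, H⟩ := main 0 0 le_rfl
    refine ⟨C, hC, ?_⟩
    intro u f h hu hf hh t O hO heq x hx hu0 hA
    refine H u f h hu hf hh t O hO heq x hx hu0 hA fun α hα => ?_
    rw [eq_zero_of_mem_spatialIdx_zero hα, pdMulti_zero, pdMulti_zero]
    simp
  | succ n ih =>
    obtain ⟨C₀, hC₀, H₀⟩ := ih
    obtain ⟨C, hC, H⟩ := main (n + 1) (2 ^ (n + 1) * (|A| * C₀)) (by positivity)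
    refine ⟨C, hC, ?_⟩
    intro u f h hu hf hh t O hO heq x hx hu0 hA
    refine H u f h hu hf hh t O hO heq x hx hu0 hA fun α hα => ?_
    refine (abs_commutator_le n (hu 0) (hf.pd 0) hα _).trans ?_
    rw [mul_assoc, mul_assoc]
    refine mul_le_mul_of_nonneg_left ?_ (by positivity)
    refine mul_le_mul ((hA 0).trans (le_abs_self A)) ?_ (jetSum_nonneg _ _ _) (abs_nonneg A)
    refine (H₀ u f h hu hf hh t O hO heq x hx hu0
      fun μ => (jetSum_mono n.le_succ _ _).trans (hA μ)).trans ?_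
    exact mul_le_mul_of_nonneg_left
      (add_le_add (jetSum_mono (Nat.le_succ _) _ _) (jetSum_mono n.le_succ _ _)) hC₀

/-- If `u^μ ∂_μ f + h = 0` on an open set in a time slice, where `u⁰ ≥ 1`, then
`u^μ ∂_μ ∂^α f` is controlled without a loss of derivatives. -/
lemma exists_abs_Dt_pdMulti_le (n : ℕ) (A : ℝ) : ∃ C, 0 ≤ C ∧
    ∀ (u : Fin 4 → Spacetime → ℝ) (f h : Spacetime → ℝ), (∀ μ, ContDiff ℝ ∞ (u μ)) →
      ContDiff ℝ ∞ f → ContDiff ℝ ∞ h → ∀ (t : ℝ) (O : Set Space), IsOpen O →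
      (∀ x ∈ O, Dt u f (t, x) + h (t, x) = 0) → ∀ x ∈ O, 1 ≤ u 0 (t, x) →
      (∀ μ, jetSum n (u μ) (t, x) ≤ A) → ∀ α ∈ spatialIdx n,
      |Dt u (pdMulti α f) (t, x)| ≤ C * (jetSum n f (t, x) + jetSum n h (t, x)) := by
  cases n with
  | zero =>
    refine ⟨1, zero_le_one, ?_⟩
    intro u f h hu hf hh t O hO heq x hx hu0 hA α hα
    rw [eq_zero_of_mem_spatialIdx_zero hα, pdMulti_zero, eq_neg_of_add_eq_zero_left (heq x hx),
      abs_neg, one_mul]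
    exact (abs_le_jetSum 0 h _).trans (le_add_of_nonneg_left (jetSum_nonneg _ _ _))
  | succ n =>
    obtain ⟨C₀, hC₀, H₀⟩ := exists_jetSum_pd_zero_le n A
    refine ⟨4 * (2 ^ (n + 1) * (|A| * (C₀ + 1))) + 1, by positivity, ?_⟩
    intro u f h hu hf hh t O hO heq x hx hu0 hA α hα
    have hα0 := (mem_spatialIdx.1 hα).2
    set p : Spacetime := (t, x)
    have hFn := jetSum_nonneg (n + 1) f p
    have hHn := jetSum_nonneg (n + 1) h p
    set X := jetSum (n + 1) f p + jetSum (n + 1) h p with hX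
    have hX0 : 0 ≤ X := by positivity
    have h0 := sum_pdMulti_add_eq_zero hu hf hh hO heq hα0 hx
    rw [show ((t, x) : Spacetime) = p from rfl] at h0
    have hjet : ∀ μ, jetSum n (pd μ f) p ≤ (C₀ + 1) * X := by
      intro μ
      by_cases hμ : μ = 0
      · subst hμ
        refine (H₀ u f h hu hf hh t O hO heq x hx hu0
          fun μ => (jetSum_mono n.le_succ _ _).trans (hA μ)).trans ?_
        exact mul_le_mul (by linarith) (add_le_add le_rfl (jetSum_mono n.le_succ _ _))
          (add_nonneg (jetSum_nonneg _ _ _) (jetSum_nonneg _ _ _)) (by positivity)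
      · refine (jetSum_pd_le hf n hμ p).trans ?_
        nlinarith
    have hcomm : ∀ μ ∈ (Finset.univ : Finset (Fin 4)),
        |pdMulti α (fun p => u μ p * pd μ f p) p - u μ p * pdMulti α (pd μ f) p|
          ≤ 2 ^ (n + 1) * (|A| * (C₀ + 1)) * X := by
      intro μ _
      refine (abs_commutator_le n (hu μ) (hf.pd μ) hα p).trans ?_
      rw [mul_assoc, mul_assoc]
      exact mul_le_mul_of_nonneg_left (mul_le_mul ((hA μ).trans (le_abs_self A)) (hjet μ)
        (jetSum_nonneg _ _ _) (abs_nonneg A)) (by positivity)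
    have h2 : Dt u (pdMulti α f) p
        = -(∑ μ, (pdMulti α (fun p => u μ p * pd μ f p) p - u μ p * pdMulti α (pd μ f) p))
          - pdMulti α h p := by
      rw [Finset.sum_sub_distrib]
      simp only [Dt, pdMulti_pd hf]
      linarith
    have h3 : |pdMulti α h p| ≤ X := (abs_pdMulti_le_jetSum hα h p).trans (by rw [hX]; linarith)
    have h4 := (Finset.abs_sum_le_sum_abs _ _).trans (Finset.sum_le_card_nsmul _ _ _ hcomm)
    rw [Finset.card_univ, Fintype.card_fin, nsmul_eq_mul] at h4
    rw [h2]
    refine (abs_sub _ _).trans ?_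
    rw [abs_neg]
    push_cast at h4
    linarith

/-- The convective derivatives of `∂^α s̃`, `|α| ≤ n`, are controlled by the spatial derivatives
of `s̃` and `ũ` up to order `n`, with a constant that depends only on spatial derivatives of the
background: time derivatives of `s` and `s̃` are eliminated by the entropy equations. -/
lemma exists_abs_Dt_pdMulti_linearized_le (n : ℕ) (A : ℝ) : ∃ C, 0 ≤ C ∧
    ∀ (u v : Fin 4 → Spacetime → ℝ) (s f : Spacetime → ℝ), (∀ μ, ContDiff ℝ ∞ (u μ)) →
      (∀ μ, ContDiff ℝ ∞ (v μ)) → ContDiff ℝ ∞ s → ContDiff ℝ ∞ f →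
      ∀ (t : ℝ) (O : Set Space), IsOpen O → (∀ x ∈ O, Dt u s (t, x) = 0) →
      (∀ x ∈ O, Dt u f (t, x) = -∑ μ, v μ (t, x) * pd μ s (t, x)) → ∀ x ∈ O, 1 ≤ u 0 (t, x) →
      (∀ μ, jetSum n (u μ) (t, x) ≤ A) → jetSum (n + 1) s (t, x) ≤ A → ∀ α ∈ spatialIdx n,
      |Dt u (pdMulti α f) (t, x)| ≤ C * (jetSum n f (t, x) + ∑ μ, jetSum n (v μ) (t, x)) := by
  obtain ⟨C₀, hC₀, H₀⟩ := exists_jetSum_pd_zero_le n A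
  obtain ⟨C₁, hC₁, H₁⟩ := exists_abs_Dt_pdMulti_le n A
  set K : ℝ := (spatialIdx n).card * 2 ^ n * ((C₀ + 1) * |A|) with hK
  refine ⟨C₁ * (1 + K), by positivity, ?_⟩
  intro u v s f hu hv hs hf t O hO hseq hfeq x hx hu0 hA hsA α hα
  set p : Spacetime := (t, x)
  have hsm : ∀ μ, ContDiff ℝ ∞ (fun p => v μ p * pd μ s p) := fun μ => (hv μ).mul (hs.pd μ)
  have hjet : ∀ μ, jetSum n (pd μ s) p ≤ (C₀ + 1) * |A| := by
    intro μ
    by_cases hμ : μ = 0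
    · subst hμ
      have h1 := H₀ u s (fun _ => 0) hu hs contDiff_const t O hO
        (fun x hx => by rw [hseq x hx, add_zero]) x hx hu0 hA
      have h2 : jetSum n (fun _ => 0) p = 0 :=
        Finset.sum_eq_zero fun α hα => by
          rw [pdMulti_const_zero (mem_spatialIdx.1 hα).2, abs_zero]
      rw [show ((t, x) : Spacetime) = p from rfl, h2, add_zero] at h1
      exact h1.trans (mul_le_mul (by linarith) (hsA.trans (le_abs_self A))
        (jetSum_nonneg _ _ _) (by positivity))
    · refine ((jetSum_pd_le hs n hμ p).trans (hsA.trans (le_abs_self A))).trans ?_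
      nlinarith [abs_nonneg A]
  have hh : jetSum n (fun p => ∑ μ, v μ p * pd μ s p) p ≤ K * ∑ μ, jetSum n (v μ) p := by
    refine (jetSum_sum_le _ hsm n p).trans ?_
    rw [Finset.mul_sum]
    refine Finset.sum_le_sum fun μ _ => (jetSum_mul_le n (hv μ) (hs.pd μ) p).trans ?_
    rw [hK, mul_assoc _ ((C₀ + 1) * |A|)]
    refine mul_le_mul_of_nonneg_left ?_ (by positivity)
    rw [mul_comm]
    exact mul_le_mul_of_nonneg_right (hjet μ) (jetSum_nonneg _ _ _)
  have h1 := H₁ u f (fun p => ∑ μ, v μ p * pd μ s p) hu hf (ContDiff.sum fun μ _ => hsm μ) t O hO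
    (fun x hx => by rw [hfeq x hx]; ring) x hx hu0 hA α hα
  refine h1.trans ?_
  rw [mul_assoc]
  refine mul_le_mul_of_nonneg_left ?_ hC₁
  have hf0 := jetSum_nonneg n f p
  have hv0 : 0 ≤ ∑ μ, jetSum n (v μ) p := Finset.sum_nonneg fun μ _ => jetSum_nonneg _ _ _
  have hK0 : 0 ≤ K := by positivity
  have : (1 + K) * (jetSum n f p + ∑ μ, jetSum n (v μ) p)
      = jetSum n f p + K * ∑ μ, jetSum n (v μ) p + (K * jetSum n f p + ∑ μ, jetSum n (v μ) p) := by
    ring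
  rw [this]
  linarith [mul_nonneg hK0 hf0]

/-! ### The moving domain -/

/-- The closed slab `[0, T] × ℝ³`. -/
def slab (T : ℝ) : Set Spacetime := Icc 0 T ×ˢ univ

lemma mem_movingDomain_iff {T : ℝ} {Ω : ℝ → Set Space} {t : ℝ} (ht : t ∈ Icc 0 T) {x : Space} :
    (t, x) ∈ movingDomain T Ω ↔ x ∈ Ω t :=
  and_iff_right ht

lemma indicator_movingDomain {T : ℝ} {Ω : ℝ → Set Space} {t : ℝ} (ht : t ∈ Icc 0 T)
    (a : Spacetime → ℝ) : (fun x => (movingDomain T Ω).indicator a (t, x))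
      = (Ω t).indicator fun x => a (t, x) := by
  classical
  ext x
  simp only [indicator_apply, mem_movingDomain_iff ht]

lemma continuous_slice {T : ℝ} {a : Spacetime → ℝ} (ha : ContinuousOn a (slab T)) {t : ℝ}
    (ht : t ∈ Icc 0 T) : Continuous fun x => a (t, x) := by
  rw [← continuousOn_univ]
  exact ha.comp (by fun_prop) fun x _ => ⟨ht, mem_univ x⟩

namespace IsBackgroundSolution

variable {γ T : ℝ} {Ω : ℝ → Set Space} {F : FluidFields}

lemma exists_isOpen (hB : IsBackgroundSolution γ T Ω F) :
    ∃ U : Set Spacetime, IsOpen U ∧ movingDomain T Ω = U ∩ slab T := by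
  obtain ⟨U, hU, h⟩ := hB.relOpen
  refine ⟨U, hU, h.trans ?_⟩
  ext p
  simp [slab]

lemma isOpen_slice (hB : IsBackgroundSolution γ T Ω F) {t : ℝ} (ht : t ∈ Icc 0 T) :
    IsOpen (Ω t) := by
  obtain ⟨U, hU, h⟩ := hB.exists_isOpen
  have : Ω t = (fun x => (t, x)) ⁻¹' U := by
    ext x
    rw [← mem_movingDomain_iff ht, h]
    exact and_iff_left ⟨ht, mem_univ _⟩
  rw [this]
  exact hU.preimage (by fun_prop)

lemma isCompact_closure (hB : IsBackgroundSolution γ T Ω F) :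
    IsCompact (closure (movingDomain T Ω)) :=
  hB.bounded.isCompact_closure

lemma exists_isCompact (hB : IsBackgroundSolution γ T Ω F) :
    ∃ K : Set Space, IsCompact K ∧ ∀ p ∈ movingDomain T Ω, p.2 ∈ K :=
  ⟨Prod.snd '' closure (movingDomain T Ω), hB.isCompact_closure.image continuous_snd,
    fun p hp => ⟨p, subset_closure hp, rfl⟩⟩

lemma volume_slice_lt_top (hB : IsBackgroundSolution γ T Ω F) {t : ℝ} (ht : t ∈ Icc 0 T) :
    volume (Ω t) < ⊤ := by
  obtain ⟨K, hK, h⟩ := hB.exists_isCompact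
  exact (measure_mono fun x hx => h (t, x) ⟨ht, hx⟩).trans_lt hK.measure_lt_top

/-- A continuous function on the closure of the moving domain is bounded there. -/
lemma exists_bound (hB : IsBackgroundSolution γ T Ω F) {a : Spacetime → ℝ}
    (ha : ContinuousOn a (closure (movingDomain T Ω))) :
    ∃ M, 0 ≤ M ∧ ∀ p ∈ movingDomain T Ω, |a p| ≤ M := by
  obtain ⟨M, hM⟩ := hB.isCompact_closure.exists_bound_of_continuousOn ha
  exact ⟨max M 0, le_max_right _ _, fun p hp => (hM p (subset_closure hp)).trans (le_max_left _ _)⟩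

/-- Forward time-like unit vectors have `u⁰ ≥ 1`. -/
lemma one_le_u_zero (hB : IsBackgroundSolution γ T Ω F) {p : Spacetime}
    (hp : p ∈ closure (movingDomain T Ω)) : 1 ≤ F.u 0 p := by
  have hsub : movingDomain T Ω ⊆ {p | 1 ≤ F.u 0 p} := by
    intro p hp
    have h1 := hB.u_unit p hp
    have h2 := hB.u_forward p hp
    simp only [mink, Fin.sum_univ_four] at h1
    simp at h1
    rw [mem_ofPred_eq]
    nlinarith [sq_nonneg (F.u 1 p), sq_nonneg (F.u 2 p), sq_nonneg (F.u 3 p)]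
  exact closure_minimal hsub (isClosed_le continuous_const (hB.smooth.u 0).continuous) hp

/-- A point either lies in the interior of the domain relative to the slab, or `r` is
arbitrarily small on the part of the domain near it. -/
lemma mem_or_r_small (hB : IsBackgroundSolution γ T Ω F) (p : Spacetime) :
    (p ∈ movingDomain T Ω ∧ ∀ᶠ y in nhdsWithin p (slab T), y ∈ movingDomain T Ω) ∨
      (p ∉ movingDomain T Ω ∧ ∀ ε > 0, ∀ᶠ y in nhdsWithin p (slab T),
        y ∈ movingDomain T Ω → F.r y < ε) := by
  by_cases hpD : p ∈ movingDomain T Ω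
  · refine Or.inl ⟨hpD, ?_⟩
    obtain ⟨U, hU, h⟩ := hB.exists_isOpen
    rw [h] at hpD ⊢
    filter_upwards [mem_nhdsWithin_of_mem_nhds (hU.mem_nhds hpD.1), self_mem_nhdsWithin]
      with y h1 h2 using ⟨h1, h2⟩
  · refine Or.inr ⟨hpD, fun ε hε => Filter.Eventually.filter_mono nhdsWithin_le_nhds ?_⟩
    by_cases hpc : p ∈ closure (movingDomain T Ω)
    · have hr : F.r p < ε := by rw [hB.r_boundary p ⟨hpc, hpD⟩]; exact hε
      filter_upwards [hB.smooth.r.continuous.continuousAt.eventually_lt_const hr] with y hy _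
      exact hy
    · filter_upwards [isClosed_closure.isOpen_compl.mem_nhds hpc] with y hy hyD
      exact absurd (subset_closure hyD) hy

/-- Functions that are `O(r^q)` with `q > 0` extend continuously by zero outside the moving
domain. -/
lemma continuousOn_indicator (hB : IsBackgroundSolution γ T Ω F) {a : Spacetime → ℝ}
    (ha : ContinuousOn a (movingDomain T Ω)) {q M : ℝ} (hq : 0 < q)
    (hM : ∀ p ∈ movingDomain T Ω, |a p| ≤ M * F.r p ^ q) :
    ContinuousOn ((movingDomain T Ω).indicator a) (slab T) := by
  intro p _
  rcases hB.mem_or_r_small p with ⟨hpD, hev⟩ | ⟨hpD, hev⟩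
  · have h1 : ContinuousWithinAt a (slab T) p :=
      (ha p hpD).mono_of_mem_nhdsWithin hev
    refine h1.congr_of_eventuallyEq ?_ (indicator_of_mem hpD a)
    filter_upwards [hev] with y hy using indicator_of_mem hy a
  · rw [ContinuousWithinAt, indicator_of_notMem hpD, Metric.tendsto_nhds]
    intro η hη
    have hM1 : 0 < |M| + 1 := by positivity
    have hε : 0 < (η / (|M| + 1)) ^ (1 / q) := by positivity
    filter_upwards [hev _ hε] with y hy
    by_cases hyD : y ∈ movingDomain T Ω
    · rw [indicator_of_mem hyD, Real.dist_eq, sub_zero]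
      have hr := hB.r_pos y hyD
      have h1 : F.r y ^ q < η / (|M| + 1) := by
        have h2 := Real.rpow_lt_rpow hr.le (hy hyD) hq
        rwa [← Real.rpow_mul (by positivity), one_div_mul_cancel hq.ne', Real.rpow_one] at h2
      have h3 : 0 < F.r y ^ q := Real.rpow_pos_of_pos hr q
      calc |a y| ≤ M * F.r y ^ q := hM y hyD
        _ ≤ (|M| + 1) * F.r y ^ q := by
          refine mul_le_mul_of_nonneg_right ?_ h3.le
          linarith [le_abs_self M]
        _ < (|M| + 1) * (η / (|M| + 1)) := by gcongr
        _ = η := by field_simp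
    · rw [indicator_of_notMem hyD, dist_self]
      exact hη

lemma hasCompactSupport_slice (hB : IsBackgroundSolution γ T Ω F) (a : Spacetime → ℝ) (t : ℝ) :
    HasCompactSupport fun x => (movingDomain T Ω).indicator a (t, x) := by
  obtain ⟨K, hK, h⟩ := hB.exists_isCompact
  refine HasCompactSupport.intro hK fun x hx => indicator_of_notMem (fun hD => hx (h _ hD)) a

lemma integrable_slice (hB : IsBackgroundSolution γ T Ω F) {a : Spacetime → ℝ}
    (ha : ContinuousOn ((movingDomain T Ω).indicator a) (slab T)) {t : ℝ} (ht : t ∈ Icc 0 T) :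
    Integrable fun x => (movingDomain T Ω).indicator a (t, x) :=
  (continuous_slice ha ht).integrable_of_hasCompactSupport (hB.hasCompactSupport_slice a t)

lemma integral_slice (hB : IsBackgroundSolution γ T Ω F) (a : Spacetime → ℝ) {t : ℝ}
    (ht : t ∈ Icc 0 T) :
    ∫ x, (movingDomain T Ω).indicator a (t, x) = ∫ x in Ω t, a (t, x) := by
  rw [← integral_indicator (hB.isOpen_slice ht).measurableSet, indicator_movingDomain ht]

lemma integrableOn_slice (hB : IsBackgroundSolution γ T Ω F) {a : Spacetime → ℝ}
    (ha : ContinuousOn ((movingDomain T Ω).indicator a) (slab T)) {t : ℝ} (ht : t ∈ Icc 0 T) :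
    IntegrableOn (fun x => a (t, x)) (Ω t) := by
  rw [← integrable_indicator_iff (hB.isOpen_slice ht).measurableSet, ← indicator_movingDomain ht]
  exact hB.integrable_slice ha ht

lemma continuousOn_integral (hB : IsBackgroundSolution γ T Ω F) {a : Spacetime → ℝ}
    (ha : ContinuousOn ((movingDomain T Ω).indicator a) (slab T)) :
    ContinuousOn (fun t => ∫ x in Ω t, a (t, x)) (Icc 0 T) := by
  obtain ⟨K, hK, h⟩ := hB.exists_isCompact
  have : ContinuousOn (fun t => ∫ x, (movingDomain T Ω).indicator a (t, x)) (Icc 0 T) :=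
    continuousOn_integral_of_compact_support hK ha
      fun t x _ hx => indicator_of_notMem (fun hD => hx (h _ hD)) a
  exact this.congr fun t ht => (hB.integral_slice a ht).symm

/-! ### Functions supported away from the free boundary -/

section Cutoff

variable {V : Set Spacetime} {b : Spacetime → ℝ} {ε : ℝ}

/-- The derivative vanishes where `r` is below the cut-off level. -/
lemma fderiv_eq_zero_of_r_lt (hB : IsBackgroundSolution γ T Ω F) (hV : IsOpen V)
    (hDV : movingDomain T Ω ⊆ V) (hb0 : ∀ p ∈ V, F.r p < ε → b p = 0) {p : Spacetime}
    (hp : p ∈ movingDomain T Ω) (hr : F.r p < ε) : fderiv ℝ b p = 0 := by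
  have : b =ᶠ[nhds p] fun _ => 0 := by
    filter_upwards [hV.mem_nhds (hDV hp),
      hB.smooth.r.continuous.continuousAt.eventually_lt_const hr] with y h1 h2 using hb0 y h1 h2
  rw [this.fderiv_eq]
  simp

lemma hasFDerivWithinAt_indicator (hB : IsBackgroundSolution γ T Ω F) (hV : IsOpen V)
    (hDV : movingDomain T Ω ⊆ V) (hb : ContDiffOn ℝ 1 b V) (hε : 0 < ε)
    (hb0 : ∀ p ∈ V, F.r p < ε → b p = 0) (p : Spacetime) :
    HasFDerivWithinAt ((movingDomain T Ω).indicator b)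
      ((movingDomain T Ω).indicator (fderiv ℝ b) p) (slab T) p := by
  rcases hB.mem_or_r_small p with ⟨hpD, hev⟩ | ⟨hpD, hev⟩
  · rw [indicator_of_mem hpD]
    have h1 : DifferentiableAt ℝ b p :=
      (hb.contDiffAt (hV.mem_nhds (hDV hpD))).differentiableAt (by simp)
    refine h1.hasFDerivAt.hasFDerivWithinAt.congr_of_eventuallyEq ?_ (indicator_of_mem hpD b)
    filter_upwards [hev] with y hy using indicator_of_mem hy b
  · rw [indicator_of_notMem hpD]
    refine (hasFDerivWithinAt_const (0 : ℝ) p _).congr_of_eventuallyEq ?_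
      (indicator_of_notMem hpD b)
    filter_upwards [hev ε hε] with y hy
    by_cases hyD : y ∈ movingDomain T Ω
    · rw [indicator_of_mem hyD, hb0 y (hDV hyD) (hy hyD)]
    · exact indicator_of_notMem hyD b

lemma continuousOn_indicator_of_cutoff (hB : IsBackgroundSolution γ T Ω F) (hε : 0 < ε)
    (hb : ContinuousOn b (movingDomain T Ω))
    (hb0 : ∀ p ∈ movingDomain T Ω, F.r p < ε → b p = 0) :
    ContinuousOn ((movingDomain T Ω).indicator b) (slab T) := by
  intro p _
  rcases hB.mem_or_r_small p with ⟨hpD, hev⟩ | ⟨hpD, hev⟩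
  · have h1 : ContinuousWithinAt b (slab T) p := (hb p hpD).mono_of_mem_nhdsWithin hev
    refine h1.congr_of_eventuallyEq ?_ (indicator_of_mem hpD b)
    filter_upwards [hev] with y hy using indicator_of_mem hy b
  · refine (continuousWithinAt_const (b := (0 : ℝ))).congr_of_eventuallyEq ?_
      (indicator_of_notMem hpD b)
    filter_upwards [hev ε hε] with y hy
    by_cases hyD : y ∈ movingDomain T Ω
    · rw [indicator_of_mem hyD, hb0 y hyD (hy hyD)]
    · exact indicator_of_notMem hyD b

lemma continuousOn_indicator_pd (hB : IsBackgroundSolution γ T Ω F) (hV : IsOpen V)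
    (hDV : movingDomain T Ω ⊆ V) (hb : ContDiffOn ℝ 1 b V) (hε : 0 < ε)
    (hb0 : ∀ p ∈ V, F.r p < ε → b p = 0) (μ : Fin 4) :
    ContinuousOn ((movingDomain T Ω).indicator (pd μ b)) (slab T) := by
  refine hB.continuousOn_indicator_of_cutoff hε ?_ fun p hp hr => ?_
  · exact ((hb.continuousOn_fderiv_of_isOpen hV le_rfl).mono hDV).clm_apply continuousOn_const
  · simp only [pd, hB.fderiv_eq_zero_of_r_lt hV hDV hb0 hp hr]
    rfl

/-- Spatial derivatives of a function supported away from the free boundary have mean zero. -/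
lemma integral_pd_eq_zero (hB : IsBackgroundSolution γ T Ω F) (hV : IsOpen V)
    (hDV : movingDomain T Ω ⊆ V) (hb : ContDiffOn ℝ 1 b V) (hε : 0 < ε)
    (hb0 : ∀ p ∈ V, F.r p < ε → b p = 0) {i : Fin 4} (hi : i ≠ 0) {t : ℝ} (ht : t ∈ Icc 0 T) :
    ∫ x in Ω t, pd i b (t, x) = 0 := by
  set w : Space → ℝ := fun x => (movingDomain T Ω).indicator b (t, x) with hw
  have hder : ∀ x, HasFDerivAt w (((movingDomain T Ω).indicator (fderiv ℝ b) (t, x)).comp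
      (ContinuousLinearMap.inr ℝ ℝ Space)) x := by
    intro x
    have h1 := hB.hasFDerivWithinAt_indicator hV hDV hb hε hb0 (t, x)
    have h2 : HasFDerivAt (fun x : Space => (t, x)) (ContinuousLinearMap.inr ℝ ℝ Space) x :=
      hasFDerivAt_prodMk_right t x
    have h3 := h1.comp x h2.hasFDerivWithinAt (s := univ) (fun y _ => ⟨ht, mem_univ y⟩)
    exact hasFDerivWithinAt_univ.1 h3
  have hpd : ∀ x, fderiv ℝ w x (coordVec i).2 = (movingDomain T Ω).indicator (pd i b) (t, x) := by
    intro x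
    rw [(hder x).fderiv]
    have hv : ((0 : ℝ), (coordVec i).2) = coordVec i := Prod.ext (coordVec_fst hi).symm rfl
    by_cases hx : (t, x) ∈ movingDomain T Ω
    · simp only [indicator_of_mem hx, pd, ContinuousLinearMap.comp_apply,
        ContinuousLinearMap.inr_apply, hv]
    · simp [indicator_of_notMem hx]
  have hcont : ContinuousOn ((movingDomain T Ω).indicator b) (slab T) := fun p _ =>
    (hB.hasFDerivWithinAt_indicator hV hDV hb hε hb0 p).continuousWithinAt
  have hint := hB.integrable_slice (hB.continuousOn_indicator_pd hV hDV hb hε hb0 i) ht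
  -- Integration by parts against the constant function `1`.
  have key := integral_mul_fderiv_eq_neg_fderiv_mul_of_integrable (μ := (volume : Measure Space))
    (f := fun _ => (1 : ℝ)) (g := w) (v := (coordVec i).2) (by simp)
    (by simpa only [one_mul, hpd] using hint)
    (by simpa only [one_mul] using hB.integrable_slice hcont ht)
    (fun x _ => differentiableAt_const _) (fun x _ => (hder x).differentiableAt)
  simp only [one_mul, hpd] at key
  rw [← hB.integral_slice _ ht, key]
  simp

/-- Differentiation under the integral sign for functions supported away from the free
boundary. -/
lemma integral_sub_integral (hB : IsBackgroundSolution γ T Ω F) (hV : IsOpen V)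
    (hDV : movingDomain T Ω ⊆ V) (hb : ContDiffOn ℝ 1 b V) (hε : 0 < ε)
    (hb0 : ∀ p ∈ V, F.r p < ε → b p = 0) {t₁ t₂ : ℝ} (ht₁ : t₁ ∈ Icc 0 T) (ht₂ : t₂ ∈ Icc 0 T) :
    ∫ t in t₁..t₂, ∫ x in Ω t, pd 0 b (t, x)
      = (∫ x in Ω t₂, b (t₂, x)) - ∫ x in Ω t₁, b (t₁, x) := by
  have hcont : ContinuousOn ((movingDomain T Ω).indicator b) (slab T) := fun p _ =>
    (hB.hasFDerivWithinAt_indicator hV hDV hb hε hb0 p).continuousWithinAt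
  have hcont' := hB.continuousOn_indicator_pd hV hDV hb hε hb0 0
  obtain ⟨K, hK, hDK⟩ := hB.exists_isCompact
  obtain ⟨M, hM⟩ := (isCompact_Icc.prod hK).exists_bound_of_continuousOn
    (hcont'.mono fun p hp => ⟨hp.1, mem_univ _⟩)
  have hsub : uIcc t₁ t₂ ⊆ Icc 0 T := uIcc_subset_Icc ht₁ ht₂
  refine intervalIntegral.integral_eq_sub_of_hasDeriv_right
    (f := fun t => ∫ x in Ω t, b (t, x)) ((hB.continuousOn_integral hcont).mono hsub) ?_
    ((hB.continuousOn_integral hcont').mono hsub).intervalIntegrable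
  intro t ht
  have ht0 : t ∈ Ioo 0 T := ⟨(le_min ht₁.1 ht₂.1).trans_lt ht.1, ht.2.trans_le (max_le ht₁.2 ht₂.2)⟩
  have htI : t ∈ Icc 0 T := Ioo_subset_Icc_self ht0
  have hnhds : Ioo 0 T ∈ nhds t := isOpen_Ioo.mem_nhds ht0
  have main := hasDerivAt_integral_of_dominated_loc_of_deriv_le (μ := (volume : Measure Space))
    (F := fun t x => (movingDomain T Ω).indicator b (t, x))
    (F' := fun t x => (movingDomain T Ω).indicator (pd 0 b) (t, x))
    (bound := K.indicator fun _ => M) hnhds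
    (by
      filter_upwards [hnhds] with τ hτ
      exact (continuous_slice hcont (Ioo_subset_Icc_self hτ)).aestronglyMeasurable)
    (hB.integrable_slice hcont htI)
    (continuous_slice hcont' htI).aestronglyMeasurable
    (by
      refine Filter.Eventually.of_forall fun x τ hτ => ?_
      by_cases hx : x ∈ K
      · rw [indicator_of_mem hx]
        exact hM (τ, x) ⟨Ioo_subset_Icc_self hτ, hx⟩
      · rw [indicator_of_notMem hx, indicator_of_notMem fun hD => hx (hDK _ hD), norm_zero])
    ((integrable_indicator_iff hK.measurableSet).2
      (integrableOn_const hK.measure_lt_top.ne))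
    (by
      refine Filter.Eventually.of_forall fun x τ hτ => ?_
      have h1 := hB.hasFDerivWithinAt_indicator hV hDV hb hε hb0 (τ, x)
      have h2 : HasDerivAt (fun τ : ℝ => (τ, x)) ((1 : ℝ), (0 : Space)) τ :=
        (hasDerivAt_id τ).prodMk (hasDerivAt_const τ x)
      have h3 := h1.comp_hasDerivWithinAt (s := Icc 0 T) τ h2.hasDerivWithinAt
        (show MapsTo _ _ (slab T) from fun y hy => ⟨hy, mem_univ x⟩)
      have h4 := h3.hasDerivAt (Icc_mem_nhds hτ.1 hτ.2)
      have h5 : (movingDomain T Ω).indicator (pd 0 b) (τ, x)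
          = (movingDomain T Ω).indicator (fderiv ℝ b) (τ, x) ((1 : ℝ), (0 : Space)) := by
        by_cases hx : (τ, x) ∈ movingDomain T Ω
        · simp only [indicator_of_mem hx]
          rfl
        · simp [indicator_of_notMem hx]
      rw [h5]
      exact h4)
  rw [← hB.integral_slice _ htI]
  refine (main.2.congr_of_eventuallyEq ?_).hasDerivWithinAt
  filter_upwards [hnhds] with τ hτ
  exact (hB.integral_slice b (Ioo_subset_Icc_self hτ)).symm

end Cutoff

end IsBackgroundSolution

/-! ### A cut-off of the power function -/

/-- The function `r^{q-2} (r - ε)₊²`: a `C¹` approximation of `r^q` on `r > 0` that vanishes for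
`r ≤ ε`. -/
def cutPow (q ε r : ℝ) : ℝ := r ^ (q - 2) * max (r - ε) 0 ^ 2

/-- The Euler derivative `r d/dr` of `cutPow q ε`. -/
def cutPowEuler (q ε r : ℝ) : ℝ :=
  r ^ (q - 2) * ((q - 2) * max (r - ε) 0 ^ 2 + 2 * r * max (r - ε) 0)

section CutPow

variable {q ε r : ℝ}

lemma cutPow_eq_zero (h : r ≤ ε) : cutPow q ε r = 0 := by
  simp [cutPow, max_eq_right (sub_nonpos.2 h)]

lemma hasDerivAt_max_zero_sq (x : ℝ) : HasDerivAt (fun x : ℝ => max x 0 ^ 2) (2 * max x 0) x := by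
  rcases lt_trichotomy x 0 with hx | rfl | hx
  · have : (fun x : ℝ => max x 0 ^ 2) =ᶠ[nhds x] fun _ => 0 := by
      filter_upwards [Iio_mem_nhds hx] with y hy
      simp [max_eq_right (show y < 0 from hy).le]
    rw [max_eq_right hx.le, mul_zero]
    exact (hasDerivAt_const x (0 : ℝ)).congr_of_eventuallyEq this
  · rw [max_self, mul_zero, hasDerivAt_iff_isLittleO]
    have h1 : (fun x : ℝ => max x 0 ^ 2 - max 0 0 ^ 2 - (x - 0) • (0 : ℝ))
        =O[nhds 0] fun x : ℝ => x ^ 2 := by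
      refine Asymptotics.IsBigO.of_bound 1 (Filter.Eventually.of_forall fun x => ?_)
      simp only [max_self, sub_zero, smul_zero, one_mul, norm_pow, Real.norm_eq_abs]
      simp only [ne_eq, OfNat.ofNat_ne_zero, not_false_eq_true, zero_pow, sub_zero, abs_pow, sq_abs]
      rcases le_total x 0 with h | h
      · rw [max_eq_right h]; simpa using sq_nonneg x
      · rw [max_eq_left h]
    refine h1.trans_isLittleO ?_
    have := Asymptotics.isLittleO_pow_pow (𝕜 := ℝ) (m := 1) (n := 2) (by norm_num)
    simpa using this
  · have : (fun x : ℝ => max x 0 ^ 2) =ᶠ[nhds x] fun x => x ^ 2 := by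
      filter_upwards [Ioi_mem_nhds hx] with y hy
      simp [max_eq_left (show 0 < y from hy).le]
    rw [max_eq_left hx.le]
    simpa using (hasDerivAt_pow 2 x).congr_of_eventuallyEq this

lemma hasDerivAt_cutPow (hr : 0 < r) :
    HasDerivAt (cutPow q ε) (cutPowEuler q ε r / r) r := by
  have h1 := Real.hasDerivAt_rpow_const (x := r) (p := q - 2) (Or.inl hr.ne')
  have h2 := (hasDerivAt_max_zero_sq (r - ε)).comp r ((hasDerivAt_id r).sub_const ε)
  refine (h1.mul h2).congr_deriv ?_
  simp only [cutPowEuler, Function.comp_apply]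
  rw [Real.rpow_sub_one hr.ne']
  simp only [id]
  field_simp

lemma contDiffOn_cutPow : ContDiffOn ℝ 1 (cutPow q ε) (Ioi 0) := by
  have h : ContDiff ℝ 1 fun x : ℝ => max x 0 ^ 2 := by
    rw [contDiff_one_iff_deriv]
    refine ⟨fun x => (hasDerivAt_max_zero_sq x).differentiableAt, ?_⟩
    rw [funext fun x => (hasDerivAt_max_zero_sq x).deriv]
    fun_prop
  refine ContDiffOn.mul (fun x hx => ?_) ?_
  · exact (Real.contDiffAt_rpow_const_of_ne (ne_of_gt hx)).contDiffWithinAt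
  · exact (h.comp (contDiff_id.sub contDiff_const)).contDiffOn

lemma continuousOn_cutPowEuler : ContinuousOn (cutPowEuler q ε) (Ioi 0) := by
  refine ContinuousOn.mul (fun x hx => ?_) (by fun_prop)
  exact (Real.continuousAt_rpow_const _ _ (Or.inl (ne_of_gt hx))).continuousWithinAt

lemma rpow_sub_two_mul_sq (hr : 0 < r) : r ^ (q - 2) * r ^ 2 = r ^ q := by
  rw [← Real.rpow_natCast r 2, ← Real.rpow_add hr]
  congr 1
  push_cast
  ring

lemma abs_cutPow_le (hr : 0 < r) (hε : 0 < ε) : |cutPow q ε r| ≤ r ^ q := by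
  have h0 : 0 ≤ max (r - ε) 0 := le_max_right _ _
  have h1 : max (r - ε) 0 ≤ r := max_le (by linarith) hr.le
  rw [← rpow_sub_two_mul_sq hr, cutPow, abs_of_nonneg (by positivity)]
  gcongr

lemma abs_cutPowEuler_le (hr : 0 < r) (hε : 0 < ε) :
    |cutPowEuler q ε r| ≤ (|q - 2| + 2) * r ^ q := by
  have h0 : 0 ≤ max (r - ε) 0 := le_max_right _ _
  have h1 : max (r - ε) 0 ≤ r := max_le (by linarith) hr.le
  rw [← rpow_sub_two_mul_sq hr, cutPowEuler, abs_mul, abs_of_pos (Real.rpow_pos_of_pos hr _),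
    mul_left_comm]
  refine mul_le_mul_of_nonneg_left ((abs_add_le _ _).trans ?_) (by positivity)
  rw [abs_mul, abs_of_nonneg (a := max (r - ε) 0 ^ 2) (by positivity),
    abs_of_nonneg (a := 2 * r * max (r - ε) 0) (by positivity)]
  have h2 : max (r - ε) 0 ^ 2 ≤ r ^ 2 := by gcongr
  nlinarith [abs_nonneg (q - 2), mul_le_mul_of_nonneg_left h1 hr.le,
    mul_le_mul_of_nonneg_left h2 (abs_nonneg (q - 2))]

lemma tendsto_max_sub (hr : 0 < r) :
    Filter.Tendsto (fun ε => max (r - ε) 0) (nhdsWithin 0 (Ioi 0)) (nhds r) := by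
  have : Continuous fun ε => max (r - ε) 0 := by fun_prop
  simpa [max_eq_left hr.le] using (this.tendsto 0).mono_left nhdsWithin_le_nhds

lemma tendsto_cutPow (hr : 0 < r) :
    Filter.Tendsto (fun ε => cutPow q ε r) (nhdsWithin 0 (Ioi 0)) (nhds (r ^ q)) := by
  rw [← rpow_sub_two_mul_sq hr]
  exact ((tendsto_max_sub hr).pow 2).const_mul _

lemma tendsto_cutPowEuler (hr : 0 < r) :
    Filter.Tendsto (fun ε => cutPowEuler q ε r) (nhdsWithin 0 (Ioi 0)) (nhds (q * r ^ q)) := by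
  have h := (((tendsto_max_sub hr).pow 2).const_mul (q - 2)).add
    ((tendsto_max_sub hr).const_mul (2 * r))
  have h2 := h.const_mul (r ^ (q - 2))
  have h3 : r ^ (q - 2) * ((q - 2) * r ^ 2 + 2 * r * r) = q * r ^ q := by
    rw [show r ^ q = r ^ (q - 2) * r ^ 2 from (rpow_sub_two_mul_sq hr).symm]; ring
  rwa [h3] at h2

end CutPow

/-! ### The transport theorem -/

/-- The divergence `∂_i (u^i / u⁰)` of the coordinate velocity. -/
def divVel (u : Fin 4 → Spacetime → ℝ) (p : Spacetime) : ℝ :=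
  ∑ i : Fin 3, pd i.succ (fun p => u i.succ p / u 0 p) p

/-- The factor `ψ` in `d/dt ∫ r^q φ = ∫ r^q ψ`. Its first term, the derivative of the weight, has
`D_t r` replaced by `-(γ-1) r ∂_μ u^μ`, so that the power of `r` is not lowered. -/
def transportDensity (γ q : ℝ) (u : Fin 4 → Spacetime → ℝ) (φ : Spacetime → ℝ)
    (p : Spacetime) : ℝ :=
  q * (-((γ - 1) * ∑ μ, pd μ (u μ) p) * φ p / u 0 p) + (Dt u φ p / u 0 p + φ p * divVel u p)

lemma continuous_Dt {u : Fin 4 → Spacetime → ℝ} {φ : Spacetime → ℝ}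
    (hu : ∀ μ, ContDiff ℝ ∞ (u μ)) (hφ : ContDiff ℝ ∞ φ) : Continuous (Dt u φ) :=
  continuous_finsetSum _ fun μ _ => (hu μ).continuous.mul (hφ.pd μ).continuous

namespace IsBackgroundSolution

variable {γ T : ℝ} {Ω : ℝ → Set Space} {F : FluidFields}

lemma contDiffOn_div_u_zero (hB : IsBackgroundSolution γ T Ω F) (μ : Fin 4) :
    ContDiffOn ℝ 1 (fun p => F.u μ p / F.u 0 p) {p | 0 < F.u 0 p} :=
  ((hB.smooth.u μ).of_le (by exact_mod_cast le_top)).contDiffOn.div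
    ((hB.smooth.u 0).of_le (by exact_mod_cast le_top)).contDiffOn fun _ hp => ne_of_gt hp

lemma isOpen_u_zero_pos (hB : IsBackgroundSolution γ T Ω F) : IsOpen {p | 0 < F.u 0 p} :=
  isOpen_lt continuous_const (hB.smooth.u 0).continuous

lemma closure_subset_u_zero_pos (hB : IsBackgroundSolution γ T Ω F) :
    closure (movingDomain T Ω) ⊆ {p | 0 < F.u 0 p} :=
  fun _ hp => zero_lt_one.trans_le (hB.one_le_u_zero hp)

lemma continuousOn_divVel (hB : IsBackgroundSolution γ T Ω F) :
    ContinuousOn (divVel F.u) (closure (movingDomain T Ω)) := by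
  refine continuousOn_finsetSum _ fun i _ => ?_
  exact (((hB.contDiffOn_div_u_zero _).continuousOn_fderiv_of_isOpen hB.isOpen_u_zero_pos
    le_rfl).mono hB.closure_subset_u_zero_pos).clm_apply continuousOn_const

variable {φ : Spacetime → ℝ} {q : ℝ}

/-- The part of the transport density that comes from differentiating `r^q`. -/
lemma continuousOn_compression (hB : IsBackgroundSolution γ T Ω F) (hφ : ContDiff ℝ ∞ φ) :
    ContinuousOn (fun p => -((γ - 1) * ∑ μ, pd μ (F.u μ) p) * φ p / F.u 0 p)
      (closure (movingDomain T Ω)) := by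
  refine ContinuousOn.div ?_ (hB.smooth.u 0).continuous.continuousOn
    fun p hp => ne_of_gt (hB.closure_subset_u_zero_pos hp)
  have h : Continuous fun p => ∑ μ, pd μ (F.u μ) p :=
    continuous_finsetSum _ fun μ _ => ((hB.smooth.u μ).pd μ).continuous
  exact ((continuous_const.mul h).neg.mul hφ.continuous).continuousOn

lemma continuousOn_advection (hB : IsBackgroundSolution γ T Ω F) (hφ : ContDiff ℝ ∞ φ) :
    ContinuousOn (fun p => Dt F.u φ p / F.u 0 p + φ p * divVel F.u p)
      (closure (movingDomain T Ω)) :=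
  ((continuous_Dt hB.smooth.u hφ).continuousOn.div (hB.smooth.u 0).continuous.continuousOn
    fun _ hp => ne_of_gt (hB.closure_subset_u_zero_pos hp)).add
    (hφ.continuous.continuousOn.mul hB.continuousOn_divVel)

lemma continuousOn_transportDensity (hB : IsBackgroundSolution γ T Ω F) (hφ : ContDiff ℝ ∞ φ)
    (q : ℝ) : ContinuousOn (transportDensity γ q F.u φ) (closure (movingDomain T Ω)) :=
  (continuousOn_const.mul (hB.continuousOn_compression hφ)).add (hB.continuousOn_advection hφ)

/-- The transport identity for the cut-off weight. -/
lemma integral_cutPow_sub (hB : IsBackgroundSolution γ T Ω F) (hφ : ContDiff ℝ ∞ φ) {ε : ℝ}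
    (hε : 0 < ε) {t₁ t₂ : ℝ} (ht₁ : t₁ ∈ Icc 0 T) (ht₂ : t₂ ∈ Icc 0 T) :
    ∫ t in t₁..t₂, ∫ x in Ω t,
        (cutPowEuler q ε (F.r (t, x))
            * (-((γ - 1) * ∑ μ, pd μ (F.u μ) (t, x)) * φ (t, x) / F.u 0 (t, x))
          + cutPow q ε (F.r (t, x))
            * (Dt F.u φ (t, x) / F.u 0 (t, x) + φ (t, x) * divVel F.u (t, x)))
      = (∫ x in Ω t₂, cutPow q ε (F.r (t₂, x)) * φ (t₂, x))
        - ∫ x in Ω t₁, cutPow q ε (F.r (t₁, x)) * φ (t₁, x) := by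
  set V : Set Spacetime := {p | 0 < F.r p} ∩ {p | 0 < F.u 0 p} with hVdef
  have hV : IsOpen V :=
    (isOpen_lt continuous_const hB.smooth.r.continuous).inter hB.isOpen_u_zero_pos
  have hDV : movingDomain T Ω ⊆ V := fun p hp => ⟨hB.r_pos p hp, hB.u_forward p hp⟩
  have hone : ∀ {g : Spacetime → ℝ}, ContDiff ℝ ∞ g → ContDiff ℝ 1 g :=
    fun hg => hg.of_le (by exact_mod_cast le_top)
  set b : Spacetime → ℝ := fun p => cutPow q ε (F.r p) * φ p with hbdef
  have hcut : ContDiffOn ℝ 1 (fun p => cutPow q ε (F.r p)) V :=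
    contDiffOn_cutPow.comp (hone hB.smooth.r).contDiffOn fun p hp => hp.1
  have hb : ContDiffOn ℝ 1 b V := hcut.mul (hone hφ).contDiffOn
  have hb0 : ∀ p ∈ V, F.r p < ε → b p = 0 := fun p _ hr => by
    simp only [hbdef, cutPow_eq_zero hr.le, zero_mul]
  set c : Fin 3 → Spacetime → ℝ := fun i p => b p * (F.u i.succ p / F.u 0 p) with hcdef
  have hvel : ∀ i : Fin 3, ContDiffOn ℝ 1 (fun p => F.u i.succ p / F.u 0 p) V :=
    fun i => (hB.contDiffOn_div_u_zero _).mono inter_subset_right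
  have hc : ∀ i, ContDiffOn ℝ 1 (c i) V := fun i => hb.mul (hvel i)
  have hc0 : ∀ i, ∀ p ∈ V, F.r p < ε → c i p = 0 := fun i p hp hr => by
    simp only [hcdef, hb0 p hp hr, zero_mul]
  rw [← hB.integral_sub_integral hV hDV hb hε hb0 ht₁ ht₂]
  refine intervalIntegral.integral_congr fun t ht => ?_
  have htI : t ∈ Icc 0 T := uIcc_subset_Icc ht₁ ht₂ ht
  -- The time derivative differs from the claimed density by a spatial divergence.
  have hpoint : ∀ p ∈ movingDomain T Ω,
      cutPowEuler q ε (F.r p) * (-((γ - 1) * ∑ μ, pd μ (F.u μ) p) * φ p / F.u 0 p)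
          + cutPow q ε (F.r p) * (Dt F.u φ p / F.u 0 p + φ p * divVel F.u p)
        = pd 0 b p + ∑ i, pd i.succ (c i) p := by
    intro p hp
    have hu0 : F.u 0 p ≠ 0 := (hB.u_forward p hp).ne'
    have hr0 := hB.r_pos p hp
    have hVp : V ∈ nhds p := hV.mem_nhds (hDV hp)
    have hbd : ∀ μ, pd μ b p
        = cutPowEuler q ε (F.r p) / F.r p * pd μ F.r p * φ p
          + cutPow q ε (F.r p) * pd μ φ p := by
      intro μ
      have h1 : HasFDerivAt (fun p => cutPow q ε (F.r p))
          ((cutPowEuler q ε (F.r p) / F.r p) • fderiv ℝ F.r p) p :=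
        (hasDerivAt_cutPow hr0).comp_hasFDerivAt p
          (hB.smooth.r.differentiableAt_of_smooth p).hasFDerivAt
      have h2 := h1.mul (hφ.differentiableAt_of_smooth p).hasFDerivAt
      simp only [pd]
      rw [show fderiv ℝ b p = _ from h2.fderiv]
      simp only [_root_.add_apply, _root_.smul_apply, smul_eq_mul]
      ring
    have hcd : ∀ i : Fin 3, pd i.succ (c i) p = pd i.succ b p * (F.u i.succ p / F.u 0 p)
        + b p * pd i.succ (fun p => F.u i.succ p / F.u 0 p) p := by
      intro i
      have h1 := ((hb.contDiffAt hVp).differentiableAt (by simp)).hasFDerivAt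
      have h2 := (((hvel i).contDiffAt hVp).differentiableAt (by simp)).hasFDerivAt
      simp only [pd]
      rw [show fderiv ℝ (c i) p = _ from (h1.mul h2).fderiv]
      simp only [_root_.add_apply, _root_.smul_apply, smul_eq_mul]
      ring
    have hreq := hB.r_eq p hp
    simp only [hcd, Finset.sum_add_distrib, ← Finset.mul_sum]
    rw [show ∑ i : Fin 3, pd i.succ (fun p => F.u i.succ p / F.u 0 p) p = divVel F.u p from rfl]
    simp only [hbd]
    simp only [Dt, hbdef]
    simp only [Dt] at hreq
    have hreq' : (γ - 1) * ∑ μ, pd μ (F.u μ) p = -(∑ μ, F.u μ p * pd μ F.r p) / F.r p := by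
      field_simp
      linarith
    rw [hreq']
    simp only [Fin.sum_univ_succ (n := 3), Fin.sum_univ_three]
    field_simp
    ring
  have hint : ∀ {g : Spacetime → ℝ}, ContDiffOn ℝ 1 g V → (∀ p ∈ V, F.r p < ε → g p = 0) →
      ∀ μ, IntegrableOn (fun x => pd μ g (t, x)) (Ω t) := fun hg hg0 μ =>
    hB.integrableOn_slice (hB.continuousOn_indicator_pd hV hDV hg hε hg0 μ) htI
  calc _ = ∫ x in Ω t, (pd 0 b (t, x) + ∑ i, pd i.succ (c i) (t, x)) :=
        setIntegral_congr_fun (hB.isOpen_slice htI).measurableSet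
          fun x hx => hpoint (t, x) ⟨htI, hx⟩
    _ = (∫ x in Ω t, pd 0 b (t, x)) + ∑ i, ∫ x in Ω t, pd i.succ (c i) (t, x) := by
        rw [integral_add (hint hb hb0 0)
          (integrable_finsetSum _ fun i _ => hint (hc i) (hc0 i) i.succ),
          integral_finsetSum _ fun i _ => hint (hc i) (hc0 i) i.succ]
    _ = ∫ x in Ω t, pd 0 b (t, x) := by
        rw [Finset.sum_eq_zero fun i _ =>
          hB.integral_pd_eq_zero hV hDV (hc i) hε (hc0 i) (Fin.succ_ne_zero i) htI, add_zero]

lemma continuousOn_indicator_rpow_mul (hB : IsBackgroundSolution γ T Ω F) (hq : 0 < q)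
    {a : Spacetime → ℝ} (ha : ContinuousOn a (closure (movingDomain T Ω))) :
    ContinuousOn ((movingDomain T Ω).indicator fun p => F.r p ^ q * a p) (slab T) := by
  obtain ⟨M, _, hM⟩ := hB.exists_bound ha
  refine hB.continuousOn_indicator (M := M) ?_ hq fun p hp => ?_
  · refine ContinuousOn.mul ?_ (ha.mono subset_closure)
    exact hB.smooth.r.continuous.continuousOn.rpow_const fun p _ => Or.inr hq.le
  · have h := Real.rpow_nonneg (hB.r_pos p hp).le q
    rw [abs_mul, abs_of_nonneg h, mul_comm]
    exact mul_le_mul_of_nonneg_right (hM p hp) h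

/-- The transport identity in integrated form, by removal of the cut-off. -/
lemma integral_rpow_sub (hB : IsBackgroundSolution γ T Ω F) (hφ : ContDiff ℝ ∞ φ) (hq : 0 < q)
    {t₁ t₂ : ℝ} (ht₁ : t₁ ∈ Icc 0 T) (ht₂ : t₂ ∈ Icc 0 T) :
    ∫ t in t₁..t₂, ∫ x in Ω t, F.r (t, x) ^ q * transportDensity γ q F.u φ (t, x)
      = (∫ x in Ω t₂, F.r (t₂, x) ^ q * φ (t₂, x)) - ∫ x in Ω t₁, F.r (t₁, x) ^ q * φ (t₁, x) := by
  set a₁ : Spacetime → ℝ := fun p => -((γ - 1) * ∑ μ, pd μ (F.u μ) p) * φ p / F.u 0 p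
  set a₂ : Spacetime → ℝ := fun p => Dt F.u φ p / F.u 0 p + φ p * divVel F.u p
  have ha₁ : ContinuousOn a₁ (closure (movingDomain T Ω)) := hB.continuousOn_compression hφ
  have ha₂ : ContinuousOn a₂ (closure (movingDomain T Ω)) := hB.continuousOn_advection hφ
  obtain ⟨M₁, hM₁0, hM₁⟩ := hB.exists_bound ha₁
  obtain ⟨M₂, hM₂0, hM₂⟩ := hB.exists_bound ha₂
  set J : ℝ → Spacetime → ℝ := fun ε p =>
    cutPowEuler q ε (F.r p) * a₁ p + cutPow q ε (F.r p) * a₂ p with hJ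
  set N : ℝ := (|q - 2| + 2) * M₁ + M₂ with hN
  have hbound : ∀ ε > 0, ∀ p ∈ movingDomain T Ω, |J ε p| ≤ N * F.r p ^ q := by
    intro ε hε p hp
    have hr := hB.r_pos p hp
    refine (abs_add_le _ _).trans ?_
    rw [abs_mul, abs_mul]
    have h1 := mul_le_mul (abs_cutPowEuler_le (q := q) hr hε) (hM₁ p hp) (abs_nonneg _)
      (by positivity)
    have h2 := mul_le_mul (abs_cutPow_le (q := q) hr hε) (hM₂ p hp) (abs_nonneg _)
      (by positivity)
    rw [hN]
    linarith
  have hrmap : MapsTo F.r (movingDomain T Ω) (Ioi 0) := fun p hp => hB.r_pos p hp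
  have hrc : ContinuousOn F.r (movingDomain T Ω) := hB.smooth.r.continuous.continuousOn
  have hcutc : ∀ ε, ContinuousOn (fun p => cutPow q ε (F.r p)) (movingDomain T Ω) := fun ε =>
    contDiffOn_cutPow.continuousOn.comp hrc hrmap
  have hJc : ∀ ε > 0, ContinuousOn ((movingDomain T Ω).indicator (J ε)) (slab T) := fun ε hε =>
    hB.continuousOn_indicator (((continuousOn_cutPowEuler.comp hrc hrmap).mul
      (ha₁.mono subset_closure)).add ((hcutc ε).mul (ha₂.mono subset_closure))) hq (hbound ε hε)
  obtain ⟨R, hR0, hR⟩ := hB.exists_bound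
    (hB.smooth.r.continuous.rpow_const fun _ => Or.inr hq.le).continuousOn
  have hN0 : 0 ≤ N := by positivity
  have hconst : ∀ ε > 0, ∀ p ∈ movingDomain T Ω, |J ε p| ≤ N * R := fun ε hε p hp =>
    (hbound ε hε p hp).trans (mul_le_mul_of_nonneg_left ((le_abs_self _).trans (hR p hp)) hN0)
  have hpos : ∀ᶠ ε in nhdsWithin (0 : ℝ) (Ioi 0), 0 < ε := self_mem_nhdsWithin
  have hfin : ∀ t ∈ Icc 0 T, ∀ C : ℝ, Integrable (fun _ => C) (volume.restrict (Ω t)) :=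
    fun t ht C => integrableOn_const (hB.volume_slice_lt_top ht).ne
  have hmeas : ∀ t ∈ Icc 0 T, MeasurableSet (Ω t) := fun t ht => (hB.isOpen_slice ht).measurableSet
  -- The slice integrals of the cut-off quantities converge to those without cut-off.
  have hinner : ∀ t ∈ Icc 0 T, Filter.Tendsto (fun ε => ∫ x in Ω t, J ε (t, x))
      (nhdsWithin 0 (Ioi 0))
      (nhds (∫ x in Ω t, F.r (t, x) ^ q * transportDensity γ q F.u φ (t, x))) := by
    intro t ht
    refine tendsto_integral_filter_of_dominated_convergence (fun _ => N * R) ?_ ?_ (hfin t ht _) ?_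
    · filter_upwards [hpos] with ε hε
      exact (hB.integrableOn_slice (hJc ε hε) ht).aestronglyMeasurable
    · filter_upwards [hpos] with ε hε
      exact ae_restrict_of_forall_mem (hmeas t ht) fun x hx => hconst ε hε (t, x) ⟨ht, hx⟩
    · refine ae_restrict_of_forall_mem (hmeas t ht) fun x hx => ?_
      have hr := hB.r_pos (t, x) ⟨ht, hx⟩
      have h := ((tendsto_cutPowEuler (q := q) hr).mul_const (a₁ (t, x))).add
        ((tendsto_cutPow (q := q) hr).mul_const (a₂ (t, x)))
      have he : q * F.r (t, x) ^ q * a₁ (t, x) + F.r (t, x) ^ q * a₂ (t, x)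
          = F.r (t, x) ^ q * transportDensity γ q F.u φ (t, x) := by
        simp only [transportDensity, a₁, a₂]
        ring
      rwa [he] at h
  obtain ⟨Φ, hΦ0, hΦ⟩ := hB.exists_bound hφ.continuous.continuousOn
  have hend : ∀ t ∈ Icc 0 T, Filter.Tendsto
      (fun ε => ∫ x in Ω t, cutPow q ε (F.r (t, x)) * φ (t, x))
      (nhdsWithin 0 (Ioi 0)) (nhds (∫ x in Ω t, F.r (t, x) ^ q * φ (t, x))) := by
    intro t ht
    have hle : ∀ ε > 0, ∀ p ∈ movingDomain T Ω,
        |cutPow q ε (F.r p) * φ p| ≤ Φ * F.r p ^ q := by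
      intro ε hε p hp
      rw [abs_mul, mul_comm Φ]
      exact mul_le_mul (abs_cutPow_le (hB.r_pos p hp) hε) (hΦ p hp) (abs_nonneg _)
        (Real.rpow_nonneg (hB.r_pos p hp).le q)
    refine tendsto_integral_filter_of_dominated_convergence (fun _ => Φ * R) ?_ ?_ (hfin t ht _) ?_
    · filter_upwards [hpos] with ε hε
      exact (hB.integrableOn_slice (hB.continuousOn_indicator
        ((hcutc ε).mul hφ.continuous.continuousOn) hq (hle ε hε)) ht).aestronglyMeasurable
    · filter_upwards [hpos] with ε hε
      exact ae_restrict_of_forall_mem (hmeas t ht) fun x hx => (hle ε hε (t, x) ⟨ht, hx⟩).trans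
        (mul_le_mul_of_nonneg_left ((le_abs_self _).trans (hR _ ⟨ht, hx⟩)) hΦ0)
    · exact ae_restrict_of_forall_mem (hmeas t ht) fun x hx =>
        (tendsto_cutPow (hB.r_pos (t, x) ⟨ht, hx⟩)).mul_const _
  obtain ⟨K, hK, hDK⟩ := hB.exists_isCompact
  have hsub : uIoc t₁ t₂ ⊆ Icc 0 T := uIoc_subset_uIcc.trans (uIcc_subset_Icc ht₁ ht₂)
  have houter : Filter.Tendsto (fun ε => ∫ t in t₁..t₂, ∫ x in Ω t, J ε (t, x))
      (nhdsWithin 0 (Ioi 0))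
      (nhds (∫ t in t₁..t₂, ∫ x in Ω t, F.r (t, x) ^ q * transportDensity γ q F.u φ (t, x))) := by
    refine intervalIntegral.tendsto_integral_filter_of_dominated_convergence
      (fun _ => N * R * (volume K).toReal) ?_ ?_ intervalIntegrable_const ?_
    · filter_upwards [hpos] with ε hε
      exact ((hB.continuousOn_integral (hJc ε hε)).mono hsub).aestronglyMeasurable
        measurableSet_uIoc
    · filter_upwards [hpos] with ε hε
      refine Filter.Eventually.of_forall fun t ht => ?_
      refine (norm_setIntegral_le_of_norm_le_const (hB.volume_slice_lt_top (hsub ht))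
        fun x hx => hconst ε hε (t, x) ⟨hsub ht, hx⟩).trans ?_
      refine mul_le_mul_of_nonneg_left ?_ (by positivity)
      exact ENNReal.toReal_mono hK.measure_lt_top.ne
        (measure_mono fun x hx => hDK (t, x) ⟨hsub ht, hx⟩)
    · exact Filter.Eventually.of_forall fun t ht => hinner t (hsub ht)
  refine tendsto_nhds_unique houter (((hend t₂ ht₂).sub (hend t₁ ht₁)).congr' ?_)
  filter_upwards [hpos] with ε hε
  exact (hB.integral_cutPow_sub hφ hε ht₁ ht₂).symm

/-- **Transport theorem** for the weights `r^q`, `q > 0`, on the moving domain. -/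
lemma hasDerivWithinAt_integral_rpow (hB : IsBackgroundSolution γ T Ω F) (hT : 0 < T)
    (hφ : ContDiff ℝ ∞ φ) (hq : 0 < q) {t : ℝ} (ht : t ∈ Icc 0 T) :
    HasDerivWithinAt (fun τ => ∫ x in Ω τ, F.r (τ, x) ^ q * φ (τ, x))
      (∫ x in Ω t, F.r (t, x) ^ q * transportDensity γ q F.u φ (t, x)) (Icc 0 T) t := by
  set G : ℝ → ℝ := fun τ => ∫ x in Ω τ, F.r (τ, x) ^ q * transportDensity γ q F.u φ (τ, x) with hG
  have hGc : ContinuousOn G (Icc 0 T) :=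
    hB.continuousOn_integral
      (hB.continuousOn_indicator_rpow_mul hq (hB.continuousOn_transportDensity hφ q))
  have h0 : (0 : ℝ) ∈ Icc 0 T := ⟨le_rfl, hT.le⟩
  -- Extend `G` continuously to the real line in order to apply the fundamental theorem.
  have hext : Continuous (IccExtend hT.le ((Icc 0 T).domRestrict G)) :=
    hGc.domRestrict.Icc_extend'
  have hGe : ∀ τ ∈ Icc 0 T, IccExtend hT.le ((Icc 0 T).domRestrict G) τ = G τ := fun τ hτ => by
    rw [IccExtend_of_mem _ _ hτ]
    rfl
  have hder := ((hext.integral_hasStrictDerivAt 0 t).hasDerivAt.const_add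
    (∫ x in Ω 0, F.r (0, x) ^ q * φ (0, x))).hasDerivWithinAt (s := Icc 0 T)
  rw [hGe t ht] at hder
  have heq : ∀ τ ∈ Icc 0 T, ∫ x in Ω τ, F.r (τ, x) ^ q * φ (τ, x)
      = (∫ x in Ω 0, F.r (0, x) ^ q * φ (0, x))
        + ∫ y in (0 : ℝ)..τ, IccExtend hT.le ((Icc 0 T).domRestrict G) y := by
    intro τ hτ
    rw [intervalIntegral.integral_congr fun y hy => hGe y (uIcc_subset_Icc h0 hτ hy), hG,
      hB.integral_rpow_sub hφ hq h0 hτ]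
    ring
  exact hder.congr heq (heq t ht)

end IsBackgroundSolution

/-! ### Supremum norms and the energy -/

/-- An almost everywhere bound of a continuous function on an open set holds everywhere. -/
lemma abs_le_of_ae_le {O : Set Space} (hO : IsOpen O) {f : Space → ℝ} (hf : Continuous f) {c : ℝ}
    (h : ∀ᵐ x ∂(volume.restrict O), |f x| ≤ c) : ∀ x ∈ O, |f x| ≤ c := by
  have h1 : (fun x => max |f x| c) =ᵐ[volume.restrict O] fun _ => c := by
    filter_upwards [h] with x hx using max_eq_right hx
  have h2 := Measure.eqOn_open_of_ae_eq h1 hO (by fun_prop) (by fun_prop)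
  exact fun x hx => (le_max_left _ _).trans_eq (h2 hx)

lemma supNorm_nonneg (Ω : ℝ → Set Space) (t : ℝ) (f : Spacetime → ℝ) : 0 ≤ supNorm Ω t f :=
  ENNReal.toReal_nonneg

section DerivSup

variable {Ω : ℝ → Set Space} {t : ℝ} {F : FluidFields} {J : Finset (Fin 4 → ℕ)}

lemma derivSup_mono {J' : Finset (Fin 4 → ℕ)} (h : J ⊆ J') :
    derivSup J Ω t F ≤ derivSup J' Ω t F :=
  Finset.sum_le_sum_of_subset_of_nonneg h fun _ _ _ =>
    add_nonneg (add_nonneg (supNorm_nonneg _ _ _) (supNorm_nonneg _ _ _))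
      (Finset.sum_nonneg fun _ _ => supNorm_nonneg _ _ _)

lemma sum_supNorm_s_le : ∑ α ∈ J, supNorm Ω t (pdMulti α F.s) ≤ derivSup J Ω t F :=
  Finset.sum_le_sum fun _ _ => (le_add_of_nonneg_right (supNorm_nonneg _ _ _)).trans
    (le_add_of_nonneg_right (Finset.sum_nonneg fun _ _ => supNorm_nonneg _ _ _))

lemma sum_supNorm_r_le : ∑ α ∈ J, supNorm Ω t (pdMulti α F.r) ≤ derivSup J Ω t F :=
  Finset.sum_le_sum fun _ _ => (le_add_of_nonneg_left (supNorm_nonneg _ _ _)).trans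
    (le_add_of_nonneg_right (Finset.sum_nonneg fun _ _ => supNorm_nonneg _ _ _))

lemma sum_supNorm_u_le (μ : Fin 4) :
    ∑ α ∈ J, supNorm Ω t (pdMulti α (F.u μ)) ≤ derivSup J Ω t F :=
  Finset.sum_le_sum fun α _ => (Finset.single_le_sum (f := fun μ => supNorm Ω t (pdMulti α (F.u μ)))
    (fun _ _ => supNorm_nonneg _ _ _) (Finset.mem_univ μ)).trans
    (le_add_of_nonneg_left (add_nonneg (supNorm_nonneg _ _ _) (supNorm_nonneg _ _ _)))

end DerivSup

lemma Gam_pos {γ : ℝ} (hγ : 1 < γ) (s : ℝ) : 0 < Gam γ s := by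
  have : 0 < γ - 1 := by linarith
  have : 0 < γ := by linarith
  unfold Gam
  positivity

lemma Gam_antitone {γ : ℝ} (hγ : 1 < γ) : Antitone (Gam γ) := by
  intro a b hab
  have h1 : 0 < γ - 1 := by linarith
  have h2 : 0 < γ := by linarith
  unfold Gam
  gcongr

lemma spatialWeight_eq {γ : ℝ} (hγ : 1 < γ) (k : ℕ) :
    (2 - γ) / (2 * (γ - 1)) + 1 / 2 + (k : ℝ) = k + 1 / (2 * (γ - 1)) := by
  have : γ - 1 ≠ 0 := by linarith
  field_simp
  ring

lemma weightedSq_nonneg (r : Spacetime → ℝ) (Ω : ℝ → Set Space) (t σ : ℝ) (f : Spacetime → ℝ) :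
    0 ≤ weightedSq r Ω t σ f :=
  integral_nonneg fun _ => sq_nonneg _

lemma energySq_summand_nonneg (γ : ℝ) (r : Spacetime → ℝ) (Ω : ℝ → Set Space) (t : ℝ)
    (L : FluidFields) (α : Fin 4 → ℕ) (a : ℕ) :
    0 ≤ weightedSq r Ω t ((2 - γ) / (2 * (γ - 1)) + 1 / 2 + a) (pdMulti α L.s)
        + weightedSq r Ω t ((2 - γ) / (2 * (γ - 1)) + a) (pdMulti α L.r)
        + ∑ μ, weightedSq r Ω t ((2 - γ) / (2 * (γ - 1)) + 1 / 2 + a) (pdMulti α (L.u μ)) :=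
  add_nonneg (add_nonneg (weightedSq_nonneg _ _ _ _ _) (weightedSq_nonneg _ _ _ _ _))
    (Finset.sum_nonneg fun _ _ => weightedSq_nonneg _ _ _ _ _)

lemma energySq_nonneg (γ : ℝ) (k : ℕ) (r : Spacetime → ℝ) (Ω : ℝ → Set Space) (t : ℝ)
    (L : FluidFields) : 0 ≤ energySq γ k r Ω t L :=
  Finset.sum_nonneg fun _ _ => Finset.sum_nonneg fun _ _ => energySq_summand_nonneg _ _ _ _ _ _ _

/-- The terms with `a = k` of the energy: all derivatives of `s̃` and `ũ` of order at most `2k`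
with the weight of the entropy norm. -/
lemma sum_weightedSq_le_energySq {γ : ℝ} (hγ : 1 < γ) (k : ℕ) (r : Spacetime → ℝ)
    (Ω : ℝ → Set Space) (t : ℝ) (L : FluidFields) :
    ∑ α ∈ spatialIdx (2 * k), (weightedSq r Ω t (k + 1 / (2 * (γ - 1))) (pdMulti α L.s)
      + ∑ μ, weightedSq r Ω t (k + 1 / (2 * (γ - 1))) (pdMulti α (L.u μ)))
      ≤ energySq γ k r Ω t L := by
  refine Finset.sum_le_sum fun α hα => ?_
  have hk : k ∈ (Finset.range (k + 1)).filter (fun a => ∑ μ, α μ ≤ k + a) := by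
    rw [Finset.mem_filter, Finset.mem_range]
    have := (mem_spatialIdx.1 hα).1
    exact ⟨by omega, by omega⟩
  refine le_trans ?_ (Finset.single_le_sum
    (fun a _ => energySq_summand_nonneg γ r Ω t L α a) hk)
  rw [spatialWeight_eq hγ k]
  linarith [weightedSq_nonneg r Ω t ((2 - γ) / (2 * (γ - 1)) + k) (pdMulti α L.r)]

/-! ### Pointwise estimates -/

/-- Elimination of `Y = ∂_t r` from the first-order equations for `X = ∂_t u⁰`. The condition
`g r κ ≤ 1/2` keeps the resulting coefficient of `X` away from zero. -/
lemma abs_le_of_eliminate {u X Y a b c g r κ : ℝ} (hu : 1 ≤ u) (hκ : 0 ≤ κ) (hgr : 0 ≤ g * r)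
    (h : g * r * κ ≤ 1 / 2) (h1 : u * Y + a + g * r * (X + b) = 0)
    (h2 : u * X + c + κ * ((u ^ 2 - 1) * Y + u * a) = 0) :
    |X| ≤ 2 * |c| + 2 * κ * |a| + |b| := by
  have hu2 : 0 ≤ u ^ 2 - 1 := by nlinarith
  have hupos : 0 < u := by linarith
  have hθ : 0 ≤ g * r * κ := mul_nonneg hgr hκ
  have key : X * (u ^ 2 - g * r * κ * (u ^ 2 - 1))
      = -(u * c) - κ * a + g * r * κ * (u ^ 2 - 1) * b := by
    linear_combination u * h2 - κ * (u ^ 2 - 1) * h1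
  have hcoef : u ^ 2 / 2 ≤ u ^ 2 - g * r * κ * (u ^ 2 - 1) := by nlinarith
  have hl : |X| * (u ^ 2 / 2) ≤ |X * (u ^ 2 - g * r * κ * (u ^ 2 - 1))| := by
    rw [abs_mul]
    exact mul_le_mul_of_nonneg_left (hcoef.trans (le_abs_self _)) (abs_nonneg X)
  have hr : |X * (u ^ 2 - g * r * κ * (u ^ 2 - 1))|
      ≤ u ^ 2 * |c| + u ^ 2 * (κ * |a|) + u ^ 2 / 2 * |b| := by
    rw [key]
    refine (abs_add_le _ _).trans (add_le_add ((abs_sub _ _).trans (add_le_add ?_ ?_)) ?_)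
    · rw [abs_neg, abs_mul, abs_of_pos hupos]
      exact mul_le_mul_of_nonneg_right (by nlinarith) (abs_nonneg c)
    · rw [abs_mul, abs_of_nonneg hκ]
      exact le_mul_of_one_le_left (mul_nonneg hκ (abs_nonneg a)) (by nlinarith)
    · rw [abs_mul, abs_of_nonneg (mul_nonneg hθ hu2)]
      exact mul_le_mul_of_nonneg_right (by nlinarith) (abs_nonneg b)
  have hfin : |X| * (u ^ 2 / 2) ≤ (2 * |c| + 2 * κ * |a| + |b|) * (u ^ 2 / 2) := by
    linarith
  exact le_of_mul_le_mul_right hfin (by positivity)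

/-- The transport density of `f²` where `u⁰ ≥ 1` and the first derivatives that it contains are
bounded. -/
lemma abs_transportDensity_sq_le {γ q A : ℝ} (hγ : 1 < γ) (hq : 0 < q)
    {u : Fin 4 → Spacetime → ℝ} (hu : ∀ μ, ContDiff ℝ ∞ (u μ)) {f : Spacetime → ℝ}
    (hf : ContDiff ℝ ∞ f) {p : Spacetime} (hu0 : 1 ≤ u 0 p) (hA : ∀ μ, |u μ p| ≤ A)
    (hdA : ∀ (i : Fin 3) (μ : Fin 4), |pd i.succ (u μ) p| ≤ A) (h0A : |pd 0 (u 0) p| ≤ A) :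
    |transportDensity γ q u (fun p => f p * f p) p|
      ≤ 2 * (|f p| * |Dt u f p|) + (q * ((γ - 1) * (4 * A)) + 6 * (A * A)) * f p ^ 2 := by
  have hg : 0 < γ - 1 := by linarith
  have hA0 : 0 ≤ A := (abs_nonneg _).trans (hA 0)
  have hupos : 0 < u 0 p := by linarith
  have hdiv : ∀ a : ℝ, |a / u 0 p| ≤ |a| := fun a => by
    rw [abs_div, abs_of_pos hupos]
    exact div_le_self (abs_nonneg a) hu0
  have hDt : Dt u (fun p => f p * f p) p = 2 * (f p * Dt u f p) := by
    simp only [Dt, pd_mul hf hf, Finset.mul_sum]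
    exact Finset.sum_congr rfl fun μ _ => by ring
  have hexp : |∑ μ, pd μ (u μ) p| ≤ 4 * A := by
    refine (Finset.abs_sum_le_sum_abs _ _).trans
      ((Finset.sum_le_card_nsmul _ _ A fun μ _ => ?_).trans_eq (by simp))
    by_cases hμ : μ = 0
    · subst hμ; exact h0A
    · obtain ⟨i, rfl⟩ := Fin.exists_succ_eq.2 hμ
      exact hdA i _
  have hquot : ∀ i : Fin 3, |pd i.succ (fun p => u i.succ p / u 0 p) p| ≤ 2 * (A * A) := by
    intro i
    have hw : DifferentiableAt ℝ (fun p => u i.succ p / u 0 p) p :=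
      (((hu i.succ).contDiffAt (x := p)).div (hu 0).contDiffAt hupos.ne').differentiableAt (by simp)
    have hprod := hw.hasFDerivAt.mul ((hu 0).differentiableAt_of_smooth p).hasFDerivAt
    have heq : u i.succ =ᶠ[nhds p] fun p => u i.succ p / u 0 p * u 0 p := by
      filter_upwards [(hu 0).continuous.continuousAt.eventually_ne hupos.ne'] with y hy
      rw [div_mul_cancel₀ _ hy]
    have h2 : pd i.succ (u i.succ) p = u i.succ p / u 0 p * pd i.succ (u 0) p
        + u 0 p * pd i.succ (fun p => u i.succ p / u 0 p) p := by
      simp only [pd]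
      rw [(hprod.congr_of_eventuallyEq heq).fderiv]
      rfl
    have h3 : pd i.succ (fun p => u i.succ p / u 0 p) p
        = (pd i.succ (u i.succ) p * u 0 p - u i.succ p * pd i.succ (u 0) p) / u 0 p / u 0 p := by
      rw [h2]
      field_simp
      ring
    rw [h3]
    refine (hdiv _).trans ((hdiv _).trans ((abs_sub _ _).trans ?_))
    rw [abs_mul, abs_mul, two_mul]
    exact add_le_add (mul_le_mul (hdA i _) (hA 0) (abs_nonneg _) hA0)
      (mul_le_mul (hA _) (hdA i 0) (abs_nonneg _) hA0)
  have hvel : |divVel u p| ≤ 6 * (A * A) := by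
    refine (Finset.abs_sum_le_sum_abs _ _).trans
      ((Finset.sum_le_card_nsmul _ _ _ fun i _ => hquot i).trans_eq ?_)
    simp; ring
  have hff : |f p * f p| = f p ^ 2 := by rw [← sq, abs_of_nonneg (sq_nonneg _)]
  rw [transportDensity, hDt]
  refine (abs_add_le _ _).trans ?_
  have t1 : |q * (-((γ - 1) * ∑ μ, pd μ (u μ) p) * (f p * f p) / u 0 p)|
      ≤ q * ((γ - 1) * (4 * A)) * f p ^ 2 := by
    rw [abs_mul, abs_of_pos hq, mul_assoc]
    refine mul_le_mul_of_nonneg_left ((hdiv _).trans ?_) hq.le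
    rw [abs_mul, abs_neg, abs_mul, abs_of_pos hg, hff]
    gcongr
  have t2 : |2 * (f p * Dt u f p) / u 0 p + f p * f p * divVel u p|
      ≤ 2 * (|f p| * |Dt u f p|) + 6 * (A * A) * f p ^ 2 := by
    refine (abs_add_le _ _).trans (add_le_add ((hdiv _).trans_eq ?_) ?_)
    · rw [abs_mul, abs_mul, abs_of_pos (zero_lt_two' ℝ)]
    · rw [abs_mul, hff, mul_comm]
      gcongr
  linarith


lemma sq_jetSum_add_sum_le (n : ℕ) (f : Spacetime → ℝ) (v : Fin 4 → Spacetime → ℝ)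
    (p : Spacetime) : (jetSum n f p + ∑ μ, jetSum n (v μ) p) ^ 2
      ≤ (spatialIdx n).card * 8 *
        ∑ α ∈ spatialIdx n, (pdMulti α f p ^ 2 + ∑ μ, pdMulti α (v μ) p ^ 2) := by
  have h : jetSum n f p + ∑ μ, jetSum n (v μ) p
      = ∑ α ∈ spatialIdx n, (|pdMulti α f p| + ∑ μ, |pdMulti α (v μ) p|) := by
    simp only [jetSum]
    rw [Finset.sum_add_distrib, Finset.sum_comm]
  rw [h, mul_assoc, Finset.mul_sum (a := (8 : ℝ))]
  refine sq_sum_le_card_mul_sum_sq.trans (mul_le_mul_of_nonneg_left ?_ (Nat.cast_nonneg _))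
  refine Finset.sum_le_sum fun α _ => ?_
  have h1 := sq_sum_le_card_mul_sum_sq (s := (Finset.univ : Finset (Fin 4)))
    (f := fun μ => |pdMulti α (v μ) p|)
  simp only [sq_abs, Finset.card_univ, Fintype.card_fin] at h1
  push_cast at h1
  have h2 := add_sq_le (a := |pdMulti α f p|) (b := ∑ μ, |pdMulti α (v μ) p|)
  rw [sq_abs] at h2
  nlinarith [sq_nonneg (pdMulti α f p)]

namespace IsBackgroundSolution

variable {γ T : ℝ} {Ω : ℝ → Set Space} {F : FluidFields} {t : ℝ}

lemma abs_le_supNorm (hB : IsBackgroundSolution γ T Ω F) (ht : t ∈ Icc 0 T) {f : Spacetime → ℝ}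
    (hf : Continuous f) : ∀ x ∈ Ω t, |f (t, x)| ≤ supNorm Ω t f := by
  have hO := hB.isOpen_slice ht
  obtain ⟨M, _, hM⟩ := hB.exists_bound hf.continuousOn
  have hfin : eLpNorm (fun x => f (t, x)) ⊤ (volume.restrict (Ω t)) ≠ ⊤ := by
    have h : ∀ᵐ x ∂(volume.restrict (Ω t)), ‖f (t, x)‖ ≤ M :=
      ae_restrict_of_forall_mem hO.measurableSet fun x hx => hM (t, x) ⟨ht, hx⟩
    rw [eLpNorm_exponent_top]
    exact (eLpNormEssSup_lt_top_of_ae_bound h).ne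
  refine abs_le_of_ae_le hO (f := fun x => f (t, x)) (by fun_prop) ?_
  have h := ae_le_eLpNormEssSup (μ := volume.restrict (Ω t)) (f := fun x => f (t, x))
  filter_upwards [h] with x hx
  rw [supNorm, ← Real.norm_eq_abs, ← toReal_enorm]
  refine ENNReal.toReal_mono hfin ?_
  rwa [eLpNorm_exponent_top]

lemma jetSum_le (hB : IsBackgroundSolution γ T Ω F) (ht : t ∈ Icc 0 T) {f : Spacetime → ℝ}
    (hf : ContDiff ℝ ∞ f) (n : ℕ) : ∀ x ∈ Ω t,
      jetSum n f (t, x) ≤ ∑ α ∈ spatialIdx n, supNorm Ω t (pdMulti α f) :=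
  fun x hx => Finset.sum_le_sum fun α _ => hB.abs_le_supNorm ht (hf.pdMulti α).continuous x hx

/-- Where `r` is small compared to `Γ(s)`, the equations express `∂_t u⁰` through spatial
derivatives. -/
lemma exists_abs_pd_zero_u_zero_le (hγ : 1 < γ) (n : ℕ) (A : ℝ) : ∃ C,
    ∀ (T : ℝ) (Ω : ℝ → Set Space) (F : FluidFields), IsBackgroundSolution γ T Ω F →
      ∀ t ∈ Icc 0 T, derivSup (spatialIdx (n + 1)) Ω t F ≤ A → ∀ S : ℝ,
      (∀ x ∈ Ω t, F.s (t, x) ≤ S ∧ F.r (t, x) ≤ Gam γ S / (2 * (γ - 1))) →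
      ∀ x ∈ Ω t, |pd 0 (F.u 0) (t, x)| ≤ C := by
  have hg : 0 < γ - 1 := by linarith
  refine ⟨2 * (3 * (|A| * |A|)) + 2 * (1 / Gam γ A) * (3 * (|A| * |A|)) + 3 * |A|, ?_⟩
  intro T Ω F hB t ht hA S hS x hx
  set p : Spacetime := (t, x) with hp
  have hpD : p ∈ movingDomain T Ω := ⟨ht, hx⟩
  have hjs : jetSum (n + 1) F.s p ≤ A :=
    (hB.jetSum_le ht hB.smooth.s _ x hx).trans (sum_supNorm_s_le.trans hA)
  have hjr : jetSum (n + 1) F.r p ≤ |A| :=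
    (hB.jetSum_le ht hB.smooth.r _ x hx).trans (sum_supNorm_r_le.trans (hA.trans (le_abs_self A)))
  have hju : ∀ μ, jetSum (n + 1) (F.u μ) p ≤ |A| := fun μ =>
    (hB.jetSum_le ht (hB.smooth.u μ) _ x hx).trans
      ((sum_supNorm_u_le μ).trans (hA.trans (le_abs_self A)))
  have hpd : ∀ {f : Spacetime → ℝ}, ContDiff ℝ ∞ f → jetSum (n + 1) f p ≤ |A| →
      ∀ i : Fin 3, |pd i.succ f p| ≤ |A| := fun hf h i =>
    (abs_le_jetSum n _ p).trans ((jetSum_pd_le hf n (Fin.succ_ne_zero i) p).trans h)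
  have hu : ∀ μ, |F.u μ p| ≤ |A| := fun μ => (abs_le_jetSum _ _ p).trans (hju μ)
  have hsum : ∀ {a : Fin 3 → ℝ} {M : ℝ}, (∀ i, |a i| ≤ M) → |∑ i, a i| ≤ 3 * M := by
    intro a M h
    refine (Finset.abs_sum_le_sum_abs _ _).trans
      ((Finset.sum_le_card_nsmul _ _ M fun i _ => h i).trans_eq ?_)
    simp
  have hr := hB.r_pos p hpD
  have hΓ := Gam_pos hγ (F.s p)
  have hΓS : Gam γ S ≤ Gam γ (F.s p) := Gam_antitone hγ (hS x hx).1
  have hΓA : Gam γ A ≤ Gam γ (F.s p) :=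
    Gam_antitone hγ ((le_abs_self _).trans ((abs_le_jetSum _ _ p).trans hjs))
  set κ : ℝ := 1 / (Gam γ (F.s p) + F.r p) with hκ
  have hκ0 : 0 ≤ κ := by positivity
  have hκA : κ ≤ 1 / Gam γ A := one_div_le_one_div_of_le (Gam_pos hγ A) (by linarith)
  have hsmall : (γ - 1) * F.r p * κ ≤ 1 / 2 := by
    have h1 : F.r p ≤ Gam γ S / (2 * (γ - 1)) := (hS x hx).2
    rw [le_div_iff₀ (by positivity)] at h1
    rw [hκ, mul_one_div, div_le_div_iff₀ (by positivity) (by norm_num)]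
    nlinarith
  -- The equation for `r` and the time component of that for `u`, split into the time derivatives
  -- and sums over the spatial indices.
  have h1 := hB.r_eq p hpD
  have h2 := hB.u_eq p hpD 0
  simp only [Dt, projU, mink, ← hκ] at h1 h2
  simp only [Fin.sum_univ_succ (n := 3)] at h1 h2
  simp only [(Fin.succ_ne_zero _).symm, if_true, if_false, zero_add] at h2
  have hr0 : ∑ i : Fin 3, F.u 0 p * F.u i.succ p * pd i.succ F.r p
      = F.u 0 p * ∑ i : Fin 3, F.u i.succ p * pd i.succ F.r p := by
    rw [Finset.mul_sum]
    exact Finset.sum_congr rfl fun i _ => mul_assoc _ _ _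
  rw [hr0] at h2
  have hfinal := abs_le_of_eliminate (u := F.u 0 p) (X := pd 0 (F.u 0) p) (Y := pd 0 F.r p)
    (a := ∑ i : Fin 3, F.u i.succ p * pd i.succ F.r p)
    (b := ∑ i : Fin 3, pd i.succ (F.u i.succ) p)
    (c := ∑ i : Fin 3, F.u i.succ p * pd i.succ (F.u 0) p) (g := γ - 1) (r := F.r p) (κ := κ)
    (hB.one_le_u_zero (subset_closure hpD)) hκ0 (by positivity) hsmall
    (by linear_combination h1) (by linear_combination h2)
  have hc : |∑ i : Fin 3, F.u i.succ p * pd i.succ (F.u 0) p| ≤ 3 * (|A| * |A|) := hsum fun i => by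
    rw [abs_mul]
    exact mul_le_mul (hu _) (hpd (hB.smooth.u 0) (hju 0) i) (abs_nonneg _) (abs_nonneg A)
  have ha : |∑ i : Fin 3, F.u i.succ p * pd i.succ F.r p| ≤ 3 * (|A| * |A|) := hsum fun i => by
    rw [abs_mul]
    exact mul_le_mul (hu _) (hpd hB.smooth.r hjr i) (abs_nonneg _) (abs_nonneg A)
  have hb : |∑ i : Fin 3, pd i.succ (F.u i.succ) p| ≤ 3 * |A| :=
    hsum fun i => hpd (hB.smooth.u _) (hju _) i
  have hka : 2 * κ * |∑ i : Fin 3, F.u i.succ p * pd i.succ F.r p|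
      ≤ 2 * (1 / Gam γ A) * (3 * (|A| * |A|)) :=
    mul_le_mul (by linarith) ha (abs_nonneg _) (by have := Gam_pos hγ A; positivity)
  linarith

/-! ### The energy estimate -/

lemma weightedSq_eq (hB : IsBackgroundSolution γ T Ω F) (ht : t ∈ Icc 0 T) (σ : ℝ)
    (f : Spacetime → ℝ) :
    weightedSq F.r Ω t σ f = ∫ x in Ω t, F.r (t, x) ^ (2 * σ) * (f (t, x) * f (t, x)) := by
  refine setIntegral_congr_fun (hB.isOpen_slice ht).measurableSet fun x hx => ?_
  have hr := hB.r_pos (t, x) ⟨ht, hx⟩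
  rw [two_mul, Real.rpow_add hr]
  ring

/-- The derivative of the entropy norm is controlled by the energy once the spatial derivatives of
the background and `∂_t u⁰` are bounded. -/
lemma exists_sum_integral_le (hγ : 1 < γ) (k : ℕ) (A : ℝ) : ∃ C, 0 ≤ C ∧
    ∀ (T : ℝ) (Ω : ℝ → Set Space) (F L : FluidFields), IsBackgroundSolution γ T Ω F →
      IsLinearizedSolution γ T Ω F L → ∀ t ∈ Icc 0 T,
      derivSup (spatialIdx (2 * k + 1)) Ω t F ≤ A → (∀ x ∈ Ω t, |pd 0 (F.u 0) (t, x)| ≤ A) →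
      ∑ α ∈ spatialIdx (2 * k), ∫ x in Ω t, F.r (t, x) ^ (2 * (k + 1 / (2 * (γ - 1)))) *
          transportDensity γ (2 * (k + 1 / (2 * (γ - 1)))) F.u
            (fun p => pdMulti α L.s p * pdMulti α L.s p) (t, x)
        ≤ C * energySq γ k F.r Ω t L := by
  have hg : 0 < γ - 1 := by linarith
  set σ : ℝ := k + 1 / (2 * (γ - 1)) with hσ
  have hq : 0 < 2 * σ := by positivity
  obtain ⟨C₀, hC₀, H₀⟩ := exists_abs_Dt_pdMulti_linearized_le (2 * k) A
  set C₁ : ℝ := 2 * C₀ + (2 * σ * ((γ - 1) * (4 * |A|)) + 6 * (|A| * |A|)) with hC₁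
  have hC₁0 : 0 ≤ C₁ := by positivity
  set m : ℝ := ((spatialIdx (2 * k)).card : ℝ) with hm
  have hm0 : 0 ≤ m := Nat.cast_nonneg _
  refine ⟨m * (C₁ * (m * 8)), by positivity, ?_⟩
  intro T Ω F L hB hL t ht hA h0
  have hO := hB.isOpen_slice ht
  set e : Spacetime → ℝ := fun p => ∑ β ∈ spatialIdx (2 * k),
    (pdMulti β L.s p * pdMulti β L.s p + ∑ μ, pdMulti β (L.u μ) p * pdMulti β (L.u μ) p) with he
  -- The pointwise estimate: no derivatives are lost.
  have hpoint : ∀ α ∈ spatialIdx (2 * k), ∀ x ∈ Ω t,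
      transportDensity γ (2 * σ) F.u (fun p => pdMulti α L.s p * pdMulti α L.s p) (t, x)
        ≤ C₁ * (m * 8) * e (t, x) := by
    intro α hα x hx
    set p : Spacetime := (t, x) with hp
    have hpD : p ∈ movingDomain T Ω := ⟨ht, hx⟩
    have hu0 : 1 ≤ F.u 0 p := hB.one_le_u_zero (subset_closure hpD)
    have hju : ∀ μ, jetSum (2 * k + 1) (F.u μ) p ≤ A := fun μ =>
      (hB.jetSum_le ht (hB.smooth.u μ) _ x hx).trans ((sum_supNorm_u_le μ).trans hA)
    have hjs : jetSum (2 * k + 1) F.s p ≤ A :=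
      (hB.jetSum_le ht hB.smooth.s _ x hx).trans (sum_supNorm_s_le.trans hA)
    have hD := H₀ F.u L.u F.s L.s hB.smooth.u hL.smooth.u hB.smooth.s hL.smooth.s t (Ω t) hO
      (fun y hy => hB.s_eq (t, y) ⟨ht, hy⟩) (fun y hy => hL.s_eq (t, y) ⟨ht, hy⟩) x hx hu0
      (fun μ => (jetSum_mono (Nat.le_succ _) _ _).trans (hju μ)) hjs α hα
    have htd := abs_transportDensity_sq_le (A := |A|) hγ hq hB.smooth.u (hL.smooth.s.pdMulti α) hu0
      (fun μ => (abs_le_jetSum _ _ p).trans ((hju μ).trans (le_abs_self A)))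
      (fun i μ => (abs_le_jetSum (2 * k) _ p).trans
        ((jetSum_pd_le (hB.smooth.u μ) _ (Fin.succ_ne_zero i) p).trans
          ((hju μ).trans (le_abs_self A))))
      ((h0 x hx).trans (le_abs_self A))
    set X : ℝ := jetSum (2 * k) L.s p + ∑ μ, jetSum (2 * k) (L.u μ) p with hX
    have hv0 : 0 ≤ ∑ μ, jetSum (2 * k) (L.u μ) p :=
      Finset.sum_nonneg fun μ _ => jetSum_nonneg _ _ _
    have hX0 : 0 ≤ X := add_nonneg (jetSum_nonneg _ _ _) hv0
    have hfX : |pdMulti α L.s p| ≤ X :=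
      (abs_pdMulti_le_jetSum hα L.s p).trans (le_add_of_nonneg_right hv0)
    have hf2 : pdMulti α L.s p ^ 2 ≤ X ^ 2 := sq_le_sq' (by linarith [(abs_le.1 hfX).1])
      (le_of_abs_le hfX)
    have hfD : |pdMulti α L.s p| * |Dt F.u (pdMulti α L.s) p| ≤ C₀ * X ^ 2 := by
      have := mul_le_mul hfX hD (abs_nonneg _) hX0
      linarith
    have hXe : X ^ 2 ≤ m * 8 * e p := by
      have := sq_jetSum_add_sum_le (2 * k) L.s L.u p
      simp only [sq (pdMulti _ _ _)] at this
      exact this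
    calc _ ≤ _ := le_abs_self _
      _ ≤ _ := htd
      _ ≤ C₁ * X ^ 2 := by
        rw [hC₁]
        have : 0 ≤ 2 * σ * ((γ - 1) * (4 * |A|)) + 6 * (|A| * |A|) := by positivity
        linarith [mul_le_mul_of_nonneg_left hf2 this]
      _ ≤ C₁ * (m * 8) * e p := by
        rw [mul_assoc]
        exact mul_le_mul_of_nonneg_left hXe hC₁0
  have hsq : ∀ {f : Spacetime → ℝ}, ContDiff ℝ ∞ f →
      IntegrableOn (fun x => F.r (t, x) ^ (2 * σ) * (f (t, x) * f (t, x))) (Ω t) := fun hf =>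
    hB.integrableOn_slice (a := fun p => F.r p ^ (2 * σ) * _)
      (hB.continuousOn_indicator_rpow_mul hq (hf.mul hf).continuous.continuousOn) ht
  have hsm : ∀ β, ContDiff ℝ ∞ (pdMulti β L.s) := fun β => hL.smooth.s.pdMulti β
  have hsmu : ∀ β μ, ContDiff ℝ ∞ (pdMulti β (L.u μ)) := fun β μ => (hL.smooth.u μ).pdMulti β
  have hec : Continuous e := continuous_finsetSum _ fun β _ =>
    ((hsm β).mul (hsm β)).continuous.add
      (continuous_finsetSum _ fun μ _ => ((hsmu β μ).mul (hsmu β μ)).continuous)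
  have hinte : ∫ x in Ω t, F.r (t, x) ^ (2 * σ) * e (t, x) ≤ energySq γ k F.r Ω t L := by
    refine le_of_eq_of_le ?_ (sum_weightedSq_le_energySq hγ k F.r Ω t L)
    simp only [he, Finset.mul_sum, mul_add, ← hσ, hB.weightedSq_eq ht]
    refine (integral_finsetSum _ fun β _ => (hsq (hsm β)).add
      (integrable_finsetSum _ fun μ _ => hsq (hsmu β μ))).trans
      (Finset.sum_congr rfl fun β _ => ?_)
    refine (integral_add (hsq (hsm β))
      (integrable_finsetSum _ fun μ _ => hsq (hsmu β μ))).trans ?_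
    rw [integral_finsetSum _ fun μ _ => hsq (hsmu β μ)]
  have hterm : ∀ α ∈ spatialIdx (2 * k), ∫ x in Ω t, F.r (t, x) ^ (2 * σ) *
      transportDensity γ (2 * σ) F.u (fun p => pdMulti α L.s p * pdMulti α L.s p) (t, x)
        ≤ C₁ * (m * 8) * energySq γ k F.r Ω t L := by
    intro α hα
    have hφ := (hsm α).mul (hsm α)
    have hi1 : IntegrableOn (fun x => F.r (t, x) ^ (2 * σ) * transportDensity γ (2 * σ) F.u
        (fun p => pdMulti α L.s p * pdMulti α L.s p) (t, x)) (Ω t) :=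
      hB.integrableOn_slice (hB.continuousOn_indicator_rpow_mul hq
        (hB.continuousOn_transportDensity hφ _)) ht
    have hi2 : IntegrableOn (fun x => F.r (t, x) ^ (2 * σ) * e (t, x)) (Ω t) :=
      hB.integrableOn_slice (hB.continuousOn_indicator_rpow_mul hq hec.continuousOn) ht
    calc _ ≤ ∫ x in Ω t, C₁ * (m * 8) * (F.r (t, x) ^ (2 * σ) * e (t, x)) := by
          refine setIntegral_mono_on hi1 (hi2.const_mul _) hO.measurableSet fun x hx => ?_
          rw [mul_left_comm]
          exact mul_le_mul_of_nonneg_left (hpoint α hα x hx)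
            (Real.rpow_nonneg (hB.r_pos (t, x) ⟨ht, hx⟩).le _)
      _ = C₁ * (m * 8) * ∫ x in Ω t, F.r (t, x) ^ (2 * σ) * e (t, x) := integral_const_mul _ _
      _ ≤ _ := mul_le_mul_of_nonneg_left hinte (by positivity)
  refine (Finset.sum_le_card_nsmul _ _ _ hterm).trans_eq ?_
  rw [nsmul_eq_mul, ← hm]
  ring

end IsBackgroundSolution

end

theorem propositionP (γ : ℝ) (hγ : 1 < γ) (k : ℕ) :
    ∃ (B₂ : ℝ → ℝ) (ε : ℝ → ℝ), Monotone B₂ ∧ (∀ S, 0 < ε S) ∧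
      ∀ (T : ℝ) (Ω : ℝ → Set Space) (F L : FluidFields), 0 < T →
        IsBackgroundSolution γ T Ω F → IsLinearizedSolution γ T Ω F L →
        ∀ t ∈ Set.Icc 0 T, ∃ E' : ℝ,
          HasDerivWithinAt
            (fun τ => sobolevSq F.r Ω τ (2 * k) (k + 1 / (2 * (γ - 1))) L.s)
            E' (Set.Icc 0 T) t ∧
          E' ≤ B₂ (derivSup (spacetimeIdx (2 * k + 1)) Ω t F) * energySq γ k F.r Ω t L ∧
          (∀ S : ℝ, (∀ x ∈ Ω t, F.s (t, x) ≤ S ∧ F.r (t, x) ≤ ε S) →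
            E' ≤ B₂ (derivSup (spatialIdx (2 * k + 1)) Ω t F) * energySq γ k F.r Ω t L) := by
  have hg : 0 < γ - 1 := by linarith
  have hσ : (0 : ℝ) < 2 * (k + 1 / (2 * (γ - 1))) := by positivity
  choose C hC H using fun A => IsBackgroundSolution.exists_sum_integral_le hγ k A
  choose D hD using fun A => IsBackgroundSolution.exists_abs_pd_zero_u_zero_le hγ (2 * k) A
  -- `C A` serves where `N ≤ A`, and `C (max A (D A))` where only `N_x ≤ A` and `r` is small. The
  -- constants for integer bounds are summed up to obtain a monotone function.
  set c : ℕ → ℝ := fun m => C m + C (max m (D m)) with hc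
  have hc0 : ∀ m, 0 ≤ c m := fun m => add_nonneg (hC _) (hC _)
  set B₂ : ℝ → ℝ := fun x => ∑ m ∈ Finset.range (⌈x⌉₊ + 1), c m with hB₂
  have hcB : ∀ x, c ⌈x⌉₊ ≤ B₂ x := fun x =>
    Finset.single_le_sum (fun m _ => hc0 m) (Finset.self_mem_range_succ _)
  refine ⟨B₂, fun S => Gam γ S / (2 * (γ - 1)), ?_, fun S => ?_, ?_⟩
  · intro x y hxy
    refine Finset.sum_le_sum_of_subset_of_nonneg ?_ fun m _ _ => hc0 m
    exact Finset.range_mono (Nat.succ_le_succ (Nat.ceil_mono hxy))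
  · have := Gam_pos hγ S
    positivity
  intro T Ω F L hT hB hL t ht
  have hen := energySq_nonneg γ k F.r Ω t L
  refine ⟨∑ α ∈ spatialIdx (2 * k), ∫ x in Ω t, F.r (t, x) ^ (2 * (k + 1 / (2 * (γ - 1)))) *
    transportDensity γ (2 * (k + 1 / (2 * (γ - 1)))) F.u
      (fun p => pdMulti α L.s p * pdMulti α L.s p) (t, x), ?_, ?_, ?_⟩
  · have h := HasDerivWithinAt.fun_sum (u := spatialIdx (2 * k)) fun α _ =>
      hB.hasDerivWithinAt_integral_rpow hT
        ((hL.smooth.s.pdMulti α).mul (hL.smooth.s.pdMulti α)) hσ ht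
    have heq : ∀ τ ∈ Set.Icc 0 T, sobolevSq F.r Ω τ (2 * k) (k + 1 / (2 * (γ - 1))) L.s
        = ∑ α ∈ spatialIdx (2 * k), ∫ x in Ω τ, F.r (τ, x) ^ (2 * (k + 1 / (2 * (γ - 1)))) *
          (pdMulti α L.s (τ, x) * pdMulti α L.s (τ, x)) := fun τ hτ =>
      Finset.sum_congr rfl fun α _ => hB.weightedSq_eq hτ _ _
    exact h.congr heq (heq t ht)
  · set N := derivSup (spacetimeIdx (2 * k + 1)) Ω t F with hN
    have hNx : derivSup (spatialIdx (2 * k + 1)) Ω t F ≤ ⌈N⌉₊ :=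
      (derivSup_mono (spatialIdx_subset_spacetimeIdx _)).trans (Nat.le_ceil N)
    refine (H ⌈N⌉₊ T Ω F L hB hL t ht hNx fun x hx => ?_).trans
      (mul_le_mul_of_nonneg_right (le_trans ?_ (hcB N)) hen)
    · refine le_trans ?_ (Nat.le_ceil N)
      have h1 := hB.abs_le_supNorm ht ((hB.smooth.u 0).pd 0).continuous x hx
      have h2 : pdMulti (Pi.single 0 1) (F.u 0) = pd 0 (F.u 0) := by
        have := pdMulti_add_single (hB.smooth.u 0) 0 0
        rwa [zero_add] at this
      rw [← h2] at h1 ⊢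
      refine h1.trans (le_trans ?_ (sum_supNorm_u_le 0))
      refine Finset.single_le_sum (f := fun α => supNorm Ω t (pdMulti α (F.u 0)))
        (fun _ _ => supNorm_nonneg _ _ _) ?_
      rw [mem_spacetimeIdx]
      simp
    · exact le_add_of_nonneg_right (hC _)
  · intro S hS
    set N := derivSup (spatialIdx (2 * k + 1)) Ω t F with hN
    have hNx : N ≤ ⌈N⌉₊ := Nat.le_ceil N
    refine (H (max ⌈N⌉₊ (D ⌈N⌉₊)) T Ω F L hB hL t ht (hNx.trans (le_max_left _ _))
      fun x hx => ?_).trans (mul_le_mul_of_nonneg_right (le_trans ?_ (hcB N)) hen)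
    · exact (hD ⌈N⌉₊ T Ω F hB t ht hNx S hS x hx).trans (le_max_right _ _)
    · exact le_add_of_nonneg_left (hC _)
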